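/- **Notation.** For $m\in\mathbb N=\{0,1,2,\dots\}$ let $P_m$ be the space of homogeneous polynomials of degree $m$ in $\mathbb C[x_1,x_2]$ with the inner product $\langle x_1^lx_2^{m-l},x_1^kx_2^{m-k}\rangle=l!\,(m-l)!\,\delta_{lk}$, with orthonormal basis $f^m_l=x_1^lx_2^{m-l}/\sqrt{l!(m-l)!}$ $(0\le l\le m)$ and with the representation $(\rho_m(g)f)(x_1,x_2)=f((x_1,x_2)g)$ of $SU(2)$. Let $\overline P_m$ be the conjugate Hilbert space, with the conjugate representation $\overline{\rho_m}$ (which equals the contragredient one). $P_m\otimes P_n$ is identified with the polynomials in $x=(x_1,x_2)$, $y=(y_1,y_2)$ of bidegree $(m,n)$ via $f\otimes g\mapsto f(x)g(y)$. Put $\Gamma=x_1y_2-y_1x_2$ (multiplication operator) and $\Delta=y_1\frac{\partial}{\partial x_1}+y_2\frac{\partial}{\partial x_2}$. For $0\le h\le\min\{m,n\}$ define real numbers $c_{m,n,h}$ by $c_{m,0,0}=1$ and, for $n\ge1$, by $$c_{m,n,h}=\frac1{(m+1)n}\begin{cases}c_{m+1,n-1,0}&h=0\\ c_{m-1,n-1,h-1}+c_{m+1,n-1,h}&0<h<n\\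 c_{m-1,n-1,h-1}&h=n,\end{cases}$$ and let $\alpha_{m,n,h}:P_{m+n-2h}\to P_m\otimes P_n$, $\alpha_{m,n,h}(f)=\sqrt{c_{m,n,h}}\,\Gamma^h\Delta^{n-h}f(x_1,x_2)$. The EPOSIC channel is $\Phi_{m,n,h}:\mathrm{End}(P_{m+n-2h})\to\mathrm{End}(P_m)$, $\Phi_{m,n,h}(A)=\mathrm{Tr}_{P_n}(\alpha_{m,n,h}A\alpha_{m,n,h}^*)$. For $r,m\in\mathbb N$ let $EC(r,m)$ be the set of all maps $\Phi_{m,n,h}$ with $n,h\in\mathbb N$, $0\le h\le\min\{m,n\}$ and $r=m+n-2h$. The Choi matrix of a linear map $\Phi:\mathrm{End}(P_r)\to\mathrm{End}(P_m)$ is $C(\Phi)=\sum_{i,j=0}^r\Phi(E_{ij})\otimes E_{ij}\in\mathrm{End}(P_m\otimes\overline P_r)$, where $E_{ij}=f^r_i(f^r_j)^*$. Let $g_0=\begin{pmatrix}0&1\\-1&0\end{pmatrix}$, let $\Theta_r:P_r\to\overline P_r$ be the linear map with $\Theta_r(f^r_l)=f^r_l$ for all $l$, and let $J_r=\Theta_r\rho_r(g_0)$.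 For $0\le l\le\min\{m,r\}$ put $\eta_{m,r,l}=(I_{P_m}\otimes J_r)\alpha_{m,r,l}:P_{m+r-2l}\to P_m\otimes\overline P_r$ and $q_{m,r,l}=\eta_{m,r,l}\eta_{m,r,l}^*$. **Proposition 3.13.** (1) Let $m,n,h\in\mathbb N$ with $0\le h\le\min\{m,n\}$ and $r=m+n-2h$. Then $P_m\otimes\overline P_r$, with the representation $\rho_m\otimes\overline{\rho_r}$, has exactly one $SU(2)$-irreducible invariant subspace $W$ of dimension $n+1$; moreover $W$ is the range of $\eta_{m,r,m-h}$, the operator $q_{m,r,m-h}$ is the orthogonal projection of $P_m\otimes\overline P_r$ onto $W$, and $$C(\Phi_{m,n,h})=\frac{r+1}{n+1}\,q_{m,r,m-h}.$$ (2) For all $r,m\in\mathbb N$ the set $EC(r,m)$ has exactly $\min\{r,m\}+1$ elements. -/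

import Mathlib

open scoped TensorProduct ComplexConjugate

noncomputable section

namespace Eposic

open MvPolynomial

/-! ### The spaces of homogeneous polynomials in two variables -/

/-- `P m`: the complex vector space of homogeneous polynomials of degree `m` in the two
variables `X 0`, `X 1` (written `x₁`, `x₂` below). -/
abbrev P (m : ℕ) : Type := ↥(homogeneousSubmodule (Fin 2) ℂ m)

/-- The exponent of the monomial `x₁ ^ l * x₂ ^ (m - l)`. -/
def expo (m l : ℕ) : Fin 2 →₀ ℕ := Finsupp.single 0 l + Finsupp.single 1 (m - l)

@[simp] lemma expo_zero (m l : ℕ) : expo m l 0 = l := by simp [expo]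

@[simp] lemma expo_one (m l : ℕ) : expo m l 1 = m - l := by simp [expo]

lemma degree_eq (d : Fin 2 →₀ ℕ) : d.degree = d 0 + d 1 := by
  simp [Finsupp.degree_eq_sum]

lemma eq_expo {m : ℕ} {d : Fin 2 →₀ ℕ} (h : d.degree = m) : d = expo m (d 0) := by
  rw [degree_eq] at h
  ext i
  fin_cases i
  · simp
  · simp; omega

lemma expo_injective (m : ℕ) : Function.Injective (expo m) := fun a b h => by
  simpa using congrArg (fun d : Fin 2 →₀ ℕ => d 0) h

/-- The monomial `x₁ ^ l * x₂ ^ (m - l)`, `0 ≤ l ≤ m`, as an element of `P m`. -/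
def mono (m : ℕ) (l : Fin (m + 1)) : P m :=
  ⟨monomial (expo m l) 1, (mem_homogeneousSubmodule _ _).2 <| by
    apply isHomogeneous_monomial
    rw [degree_eq]
    simp
    omega⟩

lemma coeff_mono (m : ℕ) (l k : Fin (m + 1)) :
    coeff (expo m k) (mono m l : MvPolynomial (Fin 2) ℂ) = if l = k then 1 else 0 := by
  simp [mono, coeff_monomial, (expo_injective m).eq_iff, Fin.ext_iff]

lemma P_ext {m : ℕ} {f g : P m}
    (h : ∀ l : Fin (m + 1), coeff (expo m l) (f : MvPolynomial (Fin 2) ℂ) = coeff (expo m l) g.1) :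
    f = g := by
  apply Subtype.ext
  ext d
  by_cases hd : d.degree = m
  · have h0 : d 0 < m + 1 := by rw [degree_eq] at hd; omega
    rw [eq_expo hd]
    exact h ⟨d 0, h0⟩
  · rw [((mem_homogeneousSubmodule _ _).1 f.2).coeff_eq_zero hd,
      ((mem_homogeneousSubmodule _ _).1 g.2).coeff_eq_zero hd]

/-- The inner product on `P m` for which the monomials `x₁ ^ l * x₂ ^ (m - l)` are orthogonal
with squared norm `l! (m - l)!`; it is conjugate-linear in the first argument. -/
def innerP (m : ℕ) (f g : P m) : ℂ :=
  ∑ l : Fin (m + 1), (((l : ℕ).factorial * (m - l).factorial : ℕ) : ℂ) *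
    (conj (coeff (expo m l) f.1) * coeff (expo m l) g.1)

lemma innerP_self (m : ℕ) (f : P m) : innerP m f f =
    ((∑ l : Fin (m + 1), (((l : ℕ).factorial * (m - l).factorial : ℕ) : ℝ) *
      ‖coeff (expo m l) f.1‖ ^ 2 : ℝ) : ℂ) := by
  simp [innerP, Complex.conj_mul']

/-- The inner product `innerP` satisfies the axioms. -/
abbrev coreP (m : ℕ) : InnerProductSpace.Core ℂ (P m) where
  inner := innerP m
  conj_inner_symm f g := by
    simp only [innerP, map_sum, map_mul, Complex.conj_conj, Complex.conj_natCast]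
    exact Finset.sum_congr rfl fun _ _ => by ring
  re_inner_nonneg f := by
    rw [innerP_self]
    simp only [RCLike.re_to_complex, Complex.ofReal_re]
    positivity
  add_left f g k := by
    simp only [innerP, Submodule.coe_add, coeff_add, map_add, ← Finset.sum_add_distrib]
    exact Finset.sum_congr rfl fun _ _ => by ring
  smul_left f g a := by
    simp only [innerP, Submodule.coe_smul, coeff_smul, smul_eq_mul, map_mul, Finset.mul_sum]
    exact Finset.sum_congr rfl fun _ _ => by ring
  definite f h := by
    change innerP m f f = 0 at h
    rw [innerP_self, Complex.ofReal_eq_zero,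
      Finset.sum_eq_zero_iff_of_nonneg (fun _ _ => by positivity)] at h
    refine P_ext fun l => ?_
    have := h l (Finset.mem_univ l)
    have h1 : (((l : ℕ).factorial * (m - l).factorial : ℕ) : ℝ) ≠ 0 := by positivity
    simpa [h1, Nat.factorial_ne_zero] using this

instance instNormedP (m : ℕ) : NormedAddCommGroup (P m) := (coreP m).toNormedAddCommGroup

instance instInnerP (m : ℕ) : InnerProductSpace ℂ (P m) := InnerProductSpace.ofCore _

lemma inner_eq (m : ℕ) (f g : P m) : inner ℂ f g = innerP m f g := rfl

/-- The vector `f_l = x₁ ^ l * x₂ ^ (m - l) / √(l! (m - l)!)` of `P m`. -/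
def canonicalVec (m : ℕ) (l : Fin (m + 1)) : P m :=
  ((1 / √((l : ℕ).factorial * (m - l).factorial) : ℝ) : ℂ) • mono m l

lemma canonicalVec_coeff (m : ℕ) (l k : Fin (m + 1)) :
    coeff (expo m k) (canonicalVec m l).1 =
      if l = k then ((1 / √((l : ℕ).factorial * (m - l).factorial) : ℝ) : ℂ) else 0 := by
  rw [canonicalVec, Submodule.coe_smul, coeff_smul, coeff_mono, smul_eq_mul]
  split_ifs <;> simp

lemma orthonormal_canonicalVec (m : ℕ) : Orthonormal ℂ (canonicalVec m) := by
  rw [orthonormal_iff_ite]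
  intro i j
  rw [inner_eq, innerP]
  simp only [canonicalVec_coeff]
  have hp : (0 : ℝ) < (i : ℕ).factorial * (m - i).factorial := by positivity
  by_cases h : i = j
  · subst h
    rw [Finset.sum_eq_single i (by intro b _ hb; simp [hb.symm]) (by simp)]
    simp only [if_true, Complex.conj_ofReal]
    rw [← Complex.ofReal_natCast, ← Complex.ofReal_mul, ← Complex.ofReal_mul, Nat.cast_mul,
      div_mul_div_comm, Real.mul_self_sqrt hp.le, one_mul, mul_one_div_cancel hp.ne',
      Complex.ofReal_one]
  · rw [if_neg h]
    refine Finset.sum_eq_zero fun x _ => ?_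
    by_cases hi : i = x
    · have hj : ¬ j = x := fun hj => h (hi.trans hj.symm)
      simp [hj]
    · simp [hi]

lemma span_canonicalVec (m : ℕ) : ⊤ ≤ Submodule.span ℂ (Set.range (canonicalVec m)) := by
  intro f _
  have key : f = ∑ l : Fin (m + 1),
      (coeff (expo m l) f.1 * ((√((l : ℕ).factorial * (m - l).factorial) : ℝ) : ℂ)) •
        canonicalVec m l := by
    refine P_ext fun k => ?_
    have hp : (0 : ℝ) < (k : ℕ).factorial * (m - k).factorial := by positivity
    simp only [Submodule.coe_sum, Submodule.coe_smul, coeff_sum, coeff_smul, canonicalVec_coeff,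
      smul_eq_mul]
    rw [Finset.sum_eq_single k (by intro b _ hb; simp [hb]) (by simp), if_pos rfl, mul_assoc,
      ← Complex.ofReal_mul, mul_one_div_cancel (Real.sqrt_pos.2 hp).ne', Complex.ofReal_one,
      mul_one]
  rw [key]
  exact Submodule.sum_mem _ fun l _ => Submodule.smul_mem _ _ (Submodule.subset_span ⟨l, rfl⟩)

/-- The canonical orthonormal basis `f_0, …, f_m` of `P m`. -/
def canonicalBasis (m : ℕ) : OrthonormalBasis (Fin (m + 1)) ℂ (P m) :=
  OrthonormalBasis.mk (orthonormal_canonicalVec m) (span_canonicalVec m)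

@[simp] lemma canonicalBasis_apply (m : ℕ) (l : Fin (m + 1)) :
    canonicalBasis m l = canonicalVec m l := by
  simp [canonicalBasis]

instance instFiniteP (m : ℕ) : FiniteDimensional ℂ (P m) :=
  (canonicalBasis m).toBasis.finiteDimensional_of_finite

/-! ### The irreducible representations of `SU(2)` -/

/-- The group `SU(2)`. -/
abbrev SU2 : Type := ↥(Matrix.specialUnitaryGroup (Fin 2) ℂ)

/-- The substitution `(x₁, x₂) ↦ (x₁, x₂) g`, that is `f ↦ f ((x₁, x₂) g)`. -/
def subst (g : Matrix (Fin 2) (Fin 2) ℂ) : MvPolynomial (Fin 2) ℂ →ₐ[ℂ] MvPolynomial (Fin 2) ℂ :=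
  aeval fun j => ∑ i, C (g i j) * X i

lemma subst_mem (g : Matrix (Fin 2) (Fin 2) ℂ) (m : ℕ) (f : MvPolynomial (Fin 2) ℂ)
    (hf : f ∈ homogeneousSubmodule (Fin 2) ℂ m) :
    subst g f ∈ homogeneousSubmodule (Fin 2) ℂ m := by
  rw [mem_homogeneousSubmodule] at hf ⊢
  have := hf.aeval (n := 1) (fun j => ∑ i, C (g i j) * X i)
    (fun j => IsHomogeneous.sum _ _ _ fun i _ => (isHomogeneous_X ℂ i).C_mul _)
  simpa [subst] using this

lemma subst_one : subst 1 = AlgHom.id ℂ _ := by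
  apply MvPolynomial.algHom_ext
  intro j
  simp [subst, Matrix.one_apply]

lemma subst_mul (g h : Matrix (Fin 2) (Fin 2) ℂ) :
    subst (g * h) = (subst g).comp (subst h) := by
  apply MvPolynomial.algHom_ext
  intro j
  simp only [subst, aeval_X, AlgHom.comp_apply,
    Matrix.mul_apply, Fin.sum_univ_two, C_add, C_mul]
  simp only [map_add, map_mul, aeval_X, algHom_C, algebraMap_eq]
  ring

/-- The representation `ρ_m` of `SU(2)` on `P m`: `(ρ_m(g) f)(x₁, x₂) = f((x₁, x₂) g)`. -/
def rho (m : ℕ) : Representation ℂ SU2 (P m) where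
  toFun g := (subst g.1).toLinearMap.restrict (subst_mem g.1 m)
  map_one' := by
    ext f : 2
    simp [LinearMap.restrict_apply, subst_one]
  map_mul' g h := by
    ext f : 2
    change subst (g.1 * h.1) f.1 = subst g.1 (subst h.1 f.1)
    rw [subst_mul]
    rfl

/-! ### The conjugate Hilbert space -/

/-- The conjugate space of `H`: the same additive group (and norm), with scalar multiplication
`(c, v) ↦ conj c • v` and inner product `⟨v, w⟩ = ⟨w, v⟩_H`. -/
def Conj (H : Type*) : Type _ := H

section Conj

variable {H K : Type*} [NormedAddCommGroup H] [InnerProductSpace ℂ H]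
  [NormedAddCommGroup K] [InnerProductSpace ℂ K]

instance instNormedConj : NormedAddCommGroup (Conj H) := inferInstanceAs (NormedAddCommGroup H)

/-- The identity map from `H` to its conjugate space. -/
def toConj : H ≃+ Conj H := AddEquiv.refl H

instance instModuleConj : Module ℂ (Conj H) where
  smul c v := toConj (conj c • toConj.symm v)
  one_smul v := by
    change toConj (conj (1 : ℂ) • toConj.symm v) = v
    simp
  mul_smul a b v := by
    change toConj (conj (a * b) • toConj.symm v) = toConj (conj a • (conj b • toConj.symm v))
    simp [mul_smul]
  smul_zero a := by
    change toConj (conj a • toConj.symm (0 : Conj H)) = 0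
    simp
  smul_add a v w := by
    change toConj (conj a • toConj.symm (v + w)) =
      toConj (conj a • toConj.symm v) + toConj (conj a • toConj.symm w)
    simp
  add_smul a b v := by
    change toConj (conj (a + b) • toConj.symm v) =
      toConj (conj a • toConj.symm v) + toConj (conj b • toConj.symm v)
    simp [add_smul]
  zero_smul v := by
    change toConj (conj (0 : ℂ) • toConj.symm v) = 0
    simp

lemma smul_toConj (c : ℂ) (v : H) : c • toConj v = toConj (conj c • v) := rfl

instance instInnerConj : InnerProductSpace ℂ (Conj H) where
  norm_smul_le c v := by
    change ‖conj c • toConj.symm v‖ ≤ ‖c‖ * ‖toConj.symm v‖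
    rw [norm_smul, RCLike.norm_conj]
  inner v w := inner ℂ (toConj.symm w) (toConj.symm v)
  norm_sq_eq_re_inner v := norm_sq_eq_re_inner (𝕜 := ℂ) (toConj.symm v)
  conj_inner_symm v w := inner_conj_symm (toConj.symm w) (toConj.symm v)
  add_left u v w := inner_add_right (toConj.symm w) (toConj.symm u) (toConj.symm v)
  smul_left v w c := by
    change inner ℂ (toConj.symm w) (conj c • toConj.symm v) = _
    rw [inner_smul_right]

lemma inner_toConj (v w : H) : inner ℂ (toConj v) (toConj w) = inner ℂ w v := rfl

instance instFiniteConj [FiniteDimensional ℂ H] : FiniteDimensional ℂ (Conj H) := by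
  let b := Module.finBasis ℂ H
  refine FiniteDimensional.of_surjective
    (⟨⟨fun c => ∑ i, c i • toConj (b i), fun x y => ?_⟩, fun a x => ?_⟩ :
      (Fin (Module.finrank ℂ H) → ℂ) →ₗ[ℂ] Conj H) fun v => ?_
  · simp [add_smul, Finset.sum_add_distrib]
  · simp [mul_smul, Finset.smul_sum]
  · refine ⟨fun i => conj (b.repr (toConj.symm v) i), ?_⟩
    change ∑ i, conj (b.repr (toConj.symm v) i) • toConj (b i) = v
    simp only [smul_toConj, Complex.conj_conj, ← map_sum, b.sum_repr]
    simp

/-- A linear map `A : H → K`, regarded as a linear map between the conjugate spaces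
(the same underlying function). -/
def conjMap (A : H →ₗ[ℂ] K) : Conj H →ₗ[ℂ] Conj K where
  toFun v := toConj (A (toConj.symm v))
  map_add' v w := by simp
  map_smul' c v := by
    change toConj (A (conj c • toConj.symm v)) = toConj (conj c • A (toConj.symm v))
    simp

/-- The conjugate representation `g ↦ conj (π g)` on the conjugate space; for a unitary `π` it
coincides with the contragredient representation. -/
def conjRep {G : Type*} [Monoid G] (π : Representation ℂ G H) : Representation ℂ G (Conj H) where
  toFun g := conjMap (π g)
  map_one' := by ext v; simp [conjMap]
  map_mul' g h := by ext v; simp [conjMap]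

/-! ### Partial trace and Choi matrix -/

/-- The rank one operator `x y^* : z ↦ ⟨y, z⟩ x`. -/
def ketbra (x : K) (y : H) : H →ₗ[ℂ] K := (InnerProductSpace.rankOne ℂ x y).toLinearMap

lemma ketbra_apply (x : K) (y z : H) : ketbra x y z = inner ℂ y z • x := by simp [ketbra]

/-- The partial trace `End (H ⊗ K) → End H` over `K`: the linear map with
`A ⊗ B ↦ tr(B) A`. -/
def partialTrace (H K : Type*) [NormedAddCommGroup H] [InnerProductSpace ℂ H]
    [NormedAddCommGroup K] [InnerProductSpace ℂ K] [FiniteDimensional ℂ H]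
    [FiniteDimensional ℂ K] :
    ((H ⊗[ℂ] K) →ₗ[ℂ] (H ⊗[ℂ] K)) →ₗ[ℂ] (H →ₗ[ℂ] H) :=
  (TensorProduct.rid ℂ (H →ₗ[ℂ] H)).toLinearMap ∘ₗ
    TensorProduct.map LinearMap.id (LinearMap.trace ℂ K) ∘ₗ
    (homTensorHomEquiv ℂ H K H K).symm.toLinearMap

lemma partialTrace_map [FiniteDimensional ℂ H] [FiniteDimensional ℂ K]
    (A : H →ₗ[ℂ] H) (B : K →ₗ[ℂ] K) :
    partialTrace H K (TensorProduct.map A B) = LinearMap.trace ℂ K B • A := by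
  have : (homTensorHomEquiv ℂ H K H K).symm (TensorProduct.map A B) = A ⊗ₜ B := by
    rw [LinearEquiv.symm_apply_eq, homTensorHomEquiv_apply]
    rfl
  simp [partialTrace, this]

/-- The Choi matrix `∑ i j, Φ(E_ij) ⊗ E_ij ∈ End (K ⊗ Conj H)` of `Φ : End H → End K`, where
`E_ij = b_i b_j^*` for an orthonormal basis `b` of `H`. -/
def choi {ι : Type*} [Fintype ι] (b : OrthonormalBasis ι ℂ H)
    (Φ : (H →ₗ[ℂ] H) →ₗ[ℂ] (K →ₗ[ℂ] K)) : (K ⊗[ℂ] Conj H) →ₗ[ℂ] (K ⊗[ℂ] Conj H) :=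
  ∑ i, ∑ j, TensorProduct.map (Φ (ketbra (b i) (b j))) (conjMap (ketbra (b i) (b j)))

lemma conjMap_sum {ι : Type*} (s : Finset ι) (A : ι → H →ₗ[ℂ] K) :
    conjMap (∑ i ∈ s, A i) = ∑ i ∈ s, conjMap (A i) := by
  ext v
  simp [conjMap]

lemma conjMap_smul (c : ℂ) (A : H →ₗ[ℂ] K) : conjMap (c • A) = conj c • conjMap A := by
  ext v
  change toConj (c • A (toConj.symm v)) = toConj (conj (conj c) • A (toConj.symm v))
  simp

/-- The Choi map is the linear extension of `A B^* ↦ A ⊗ conj B`, where `B^*` is the linear form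
`X ↦ tr(B^* X)` on `End H`; in particular it does not depend on the basis. -/
lemma choi_smulRight [FiniteDimensional ℂ H] {ι : Type*} [Fintype ι]
    (b : OrthonormalBasis ι ℂ H) (A : K →ₗ[ℂ] K) (B : H →ₗ[ℂ] H) :
    choi b ((LinearMap.trace ℂ H ∘ₗ LinearMap.mulLeft ℂ (LinearMap.adjoint B)).smulRight A) =
      TensorProduct.map A (conjMap B) := by
  classical
  have htr : ∀ i j, LinearMap.trace ℂ H (LinearMap.adjoint B * ketbra (b i) (b j)) =
      conj (inner ℂ (b i) (B (b j))) := by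
    intro i j
    rw [LinearMap.trace_eq_sum_inner _ b]
    simp only [Module.End.mul_apply, ketbra_apply, LinearMap.map_smul, inner_smul_right,
      LinearMap.adjoint_inner_right, OrthonormalBasis.inner_eq_ite, inner_conj_symm]
    simp
  have hB : B = ∑ i, ∑ j, inner ℂ (b i) (B (b j)) • ketbra (b i) (b j) := by
    apply b.toBasis.ext
    intro k
    simp [ketbra_apply, OrthonormalBasis.inner_eq_ite, b.sum_repr']
  conv_rhs => rw [hB]
  simp only [choi, LinearMap.smulRight_apply, LinearMap.comp_apply, LinearMap.mulLeft_apply, htr,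
    conjMap_sum, conjMap_smul]
  ext v w
  simp [TensorProduct.tmul_sum, TensorProduct.smul_tmul', TensorProduct.tmul_smul]

end Conj

/-! ### The isometries `α` and the EPOSIC channels -/

/-- Polynomials in the two pairs of variables `x₁, x₂` (`Sum.inl 0`, `Sum.inl 1`) and
`y₁, y₂` (`Sum.inr 0`, `Sum.inr 1`). -/
abbrev Poly4 : Type := MvPolynomial (Fin 2 ⊕ Fin 2) ℂ

/-- The bidegree weights: `x_i` has bidegree `(1, 0)` and `y_i` has bidegree `(0, 1)`. -/
def biweight : Fin 2 ⊕ Fin 2 → ℕ × ℕ := Sum.elim (fun _ => (1, 0)) (fun _ => (0, 1))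

/-- The embedding `P m ⊗ P n → ℂ[x, y]`, `f ⊗ g ↦ f(x) g(y)`. -/
def tensorToPoly (m n : ℕ) : P m ⊗[ℂ] P n →ₗ[ℂ] Poly4 :=
  TensorProduct.lift (((LinearMap.mul ℂ Poly4).compl₁₂
    ((rename Sum.inl).toLinearMap ∘ₗ (homogeneousSubmodule (Fin 2) ℂ m).subtype))
    ((rename Sum.inr).toLinearMap ∘ₗ (homogeneousSubmodule (Fin 2) ℂ n).subtype))

@[simp] lemma tensorToPoly_tmul (m n : ℕ) (f : P m) (g : P n) :
    tensorToPoly m n (f ⊗ₜ g) = rename Sum.inl f.1 * rename Sum.inr g.1 := rfl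

/-- The exponent of `x₁ ^ s * x₂ ^ (m - s) * y₁ ^ t * y₂ ^ (n - t)`. -/
def biexpo (m n s t : ℕ) : Fin 2 ⊕ Fin 2 →₀ ℕ :=
  (expo m s).mapDomain Sum.inl + (expo n t).mapDomain Sum.inr

/-- The inverse of the embedding `tensorToPoly` on the polynomials of bidegree `(m, n)`:
it sends `x₁ ^ s * x₂ ^ (m - s) * y₁ ^ t * y₂ ^ (n - t)` to
`x₁ ^ s * x₂ ^ (m - s) ⊗ x₁ ^ t * x₂ ^ (n - t)` (and the other monomials to `0`). -/
def polyToTensor (m n : ℕ) : Poly4 →ₗ[ℂ] P m ⊗[ℂ] P n :=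
  ∑ s : Fin (m + 1), ∑ t : Fin (n + 1),
    (lcoeff ℂ (biexpo m n s t)).smulRight (mono m s ⊗ₜ[ℂ] mono n t)

lemma biexpo_inl (m n s t : ℕ) (i : Fin 2) : biexpo m n s t (Sum.inl i) = expo m s i := by
  rw [biexpo, Finsupp.add_apply, Finsupp.mapDomain_apply Sum.inl_injective,
    Finsupp.mapDomain_of_notMem_range _ _ (by simp), add_zero]

lemma biexpo_inr (m n s t : ℕ) (i : Fin 2) : biexpo m n s t (Sum.inr i) = expo n t i := by
  rw [biexpo, Finsupp.add_apply, Finsupp.mapDomain_apply Sum.inr_injective,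
    Finsupp.mapDomain_of_notMem_range _ _ (by simp), zero_add]

lemma biexpo_inj {m n s t s' t' : ℕ} : biexpo m n s t = biexpo m n s' t' ↔ s = s' ∧ t = t' := by
  refine ⟨fun h => ⟨?_, ?_⟩, by rintro ⟨rfl, rfl⟩; rfl⟩
  · simpa [biexpo_inl] using DFunLike.congr_fun h (Sum.inl 0)
  · simpa [biexpo_inr] using DFunLike.congr_fun h (Sum.inr 0)

lemma tensorToPoly_mono (m n : ℕ) (s : Fin (m + 1)) (t : Fin (n + 1)) :
    tensorToPoly m n (mono m s ⊗ₜ mono n t) = monomial (biexpo m n s t) 1 := by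
  rw [tensorToPoly_tmul, mono, mono, rename_monomial, rename_monomial, monomial_mul, one_mul]
  rfl

lemma polyToTensor_monomial (m n : ℕ) (s : Fin (m + 1)) (t : Fin (n + 1)) :
    polyToTensor m n (monomial (biexpo m n s t) 1) = mono m s ⊗ₜ mono n t := by
  simp only [polyToTensor, LinearMap.sum_apply, LinearMap.smulRight_apply, lcoeff_apply,
    coeff_monomial, biexpo_inj]
  rw [Finset.sum_eq_single s, Finset.sum_eq_single t]
  · simp
  · intro b _ hb
    rw [if_neg (fun h => hb (Fin.ext h.2.symm)), zero_smul]
  · simp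
  · intro b _ hb
    refine Finset.sum_eq_zero fun c _ => ?_
    rw [if_neg (fun h => hb (Fin.ext h.1.symm)), zero_smul]
  · simp

/-- `polyToTensor` is a left inverse of the embedding `P m ⊗ P n → ℂ[x, y]`. -/
lemma polyToTensor_tensorToPoly (m n : ℕ) (z : P m ⊗[ℂ] P n) :
    polyToTensor m n (tensorToPoly m n z) = z := by
  suffices h : polyToTensor m n ∘ₗ tensorToPoly m n = LinearMap.id from
    DFunLike.congr_fun h z
  refine ((canonicalBasis m).toBasis.tensorProduct (canonicalBasis n).toBasis).ext ?_
  rintro ⟨s, t⟩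
  simp only [Module.Basis.tensorProduct_apply, OrthonormalBasis.coe_toBasis, canonicalBasis_apply,
    canonicalVec, LinearMap.comp_apply, LinearMap.id_apply]
  rw [TensorProduct.smul_tmul_smul, map_smul, map_smul, tensorToPoly_mono, polyToTensor_monomial]

/-- On polynomials of bidegree `(m, n)`, `polyToTensor` is a right inverse of the embedding
`P m ⊗ P n → ℂ[x, y]`. -/
lemma tensorToPoly_polyToTensor {m n : ℕ} {p : Poly4}
    (hp : IsWeightedHomogeneous biweight p (m, n)) :
    tensorToPoly m n (polyToTensor m n p) = p := by
  simp only [polyToTensor, LinearMap.sum_apply, LinearMap.smulRight_apply, lcoeff_apply, map_sum,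
    map_smul, tensorToPoly_mono]
  ext d
  simp only [coeff_sum, coeff_smul, coeff_monomial, smul_eq_mul]
  by_cases hd : coeff d p = 0
  · rw [hd]
    refine Finset.sum_eq_zero fun s _ => Finset.sum_eq_zero fun t _ => ?_
    split_ifs with h
    · rw [h, hd, zero_mul]
    · rw [mul_zero]
  · have hw := hp hd
    simp only [Finsupp.weight_apply, biweight, Finsupp.sum_fintype, zero_smul, implies_true,
      Fintype.sum_sum_type, Sum.elim_inl, Sum.elim_inr, Fin.sum_univ_two, Prod.ext_iff,
      Prod.fst_add, Prod.snd_add, Prod.smul_fst, Prod.smul_snd, smul_eq_mul, mul_one,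
      mul_zero, add_zero, zero_add] at hw
    have hde : d = biexpo m n (d (Sum.inl 0)) (d (Sum.inr 0)) := by
      ext i
      rcases i with i | i <;> fin_cases i <;> simp [biexpo_inl, biexpo_inr] <;> omega
    set s : Fin (m + 1) := ⟨d (Sum.inl 0), by omega⟩
    set t : Fin (n + 1) := ⟨d (Sum.inr 0), by omega⟩
    have hst : d = biexpo m n s t := hde
    rw [hst, Finset.sum_eq_single s, Finset.sum_eq_single t]
    · simp
    · intro b _ hb
      rw [if_neg (fun h => hb (Fin.ext (biexpo_inj.1 h).2)), mul_zero]
    · simp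
    · intro b _ hb
      refine Finset.sum_eq_zero fun c _ => ?_
      rw [if_neg (fun h => hb (Fin.ext (biexpo_inj.1 h).1)), mul_zero]
    · simp

/-- The operator `Γ`: multiplication by `x₁ y₂ - y₁ x₂`. -/
def gammaXY : Module.End ℂ Poly4 :=
  LinearMap.mulLeft ℂ (X (Sum.inl 0) * X (Sum.inr 1) - X (Sum.inr 0) * X (Sum.inl 1))

/-- The polarization operator `y₁ ∂/∂x₁ + y₂ ∂/∂x₂`. -/
def deltaYX : Module.End ℂ Poly4 :=
  LinearMap.mulLeft ℂ (X (Sum.inr 0)) ∘ₗ (pderiv (Sum.inl 0)).toLinearMap +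
    LinearMap.mulLeft ℂ (X (Sum.inr 1)) ∘ₗ (pderiv (Sum.inl 1)).toLinearMap

/-- The Clebsch-Gordan coefficients `c_{m,n,h}`, `0 ≤ h ≤ min m n` (other values are irrelevant). -/
def cgCoeff : ℕ → ℕ → ℕ → ℝ
  | _, 0, _ => 1
  | m, n + 1, 0 => 1 / ((m + 1) * (n + 1)) * cgCoeff (m + 1) n 0
  | m, n + 1, h + 1 =>
      if h + 1 < n + 1 then
        1 / ((m + 1) * (n + 1)) * (cgCoeff (m - 1) n h + cgCoeff (m + 1) n (h + 1))
      else 1 / ((m + 1) * (n + 1)) * cgCoeff (m - 1) n h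

/-- The map `α_{m,n,h} : P r → P m ⊗ P n`, `f ↦ √c_{m,n,h} Γ^h Δ_{yx}^{n-h} f(x₁, x₂)`, where
polynomials of bidegree `(m, n)` are identified with elements of `P m ⊗ P n`. It is used only for
`h ≤ min m n` and `r = m + n - 2h`. -/
def alpha (m n h r : ℕ) : P r →ₗ[ℂ] P m ⊗[ℂ] P n :=
  ((√(cgCoeff m n h) : ℝ) : ℂ) • (polyToTensor m n ∘ₗ (gammaXY ^ h) ∘ₗ (deltaYX ^ (n - h)) ∘ₗ
    (rename Sum.inl).toLinearMap ∘ₗ (homogeneousSubmodule (Fin 2) ℂ r).subtype)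

lemma rename_inl_bihomogeneous {r : ℕ} (f : P r) :
    IsWeightedHomogeneous biweight (rename Sum.inl f.1 : Poly4) (r, 0) := by
  intro d hd
  obtain ⟨u, rfl, hu⟩ := coeff_rename_ne_zero _ _ _ hd
  have h := ((mem_homogeneousSubmodule _ _).1 f.2) hu
  have h2 : u 0 + u 1 = r := by
    have := degree_eq u
    rw [Finsupp.degree_eq_weight_one] at this
    exact this ▸ h
  have e1 : ∀ i, (u.mapDomain (Sum.inl : Fin 2 → Fin 2 ⊕ Fin 2)) (Sum.inl i) = u i := fun i =>
    Finsupp.mapDomain_apply Sum.inl_injective _ _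
  have e2 : ∀ i, (u.mapDomain (Sum.inl : Fin 2 → Fin 2 ⊕ Fin 2)) (Sum.inr i) = 0 := fun i =>
    Finsupp.mapDomain_of_notMem_range _ _ (by simp)
  simp only [Finsupp.weight_apply, biweight, Finsupp.sum_fintype, zero_smul, implies_true,
    Fintype.sum_sum_type, Sum.elim_inl, Sum.elim_inr, Fin.sum_univ_two, Prod.ext_iff,
    Prod.fst_add, Prod.snd_add, Prod.smul_fst, Prod.smul_snd, smul_eq_mul, mul_one,
    mul_zero, add_zero, e1, e2, h2, and_self]

lemma deltaYX_bihomogeneous {m n : ℕ} {p : Poly4}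
    (hp : IsWeightedHomogeneous biweight p (m + 1, n)) :
    IsWeightedHomogeneous biweight (deltaYX p) (m, n + 1) := by
  have h : ∀ i : Fin 2, IsWeightedHomogeneous biweight
      (X (Sum.inr i) * pderiv (Sum.inl i) p : Poly4) (m, n + 1) := fun i => by
    have h1 : IsWeightedHomogeneous biweight (pderiv (Sum.inl i) p) (m, n) :=
      hp.pderiv (by simp [biweight])
    have h2 := (isWeightedHomogeneous_X ℂ biweight (Sum.inr i)).mul h1
    have h3 : biweight (Sum.inr i) + (m, n) = (m, n + 1) := by simp [biweight, add_comm]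
    rwa [h3] at h2
  exact (h 0).add (h 1)

lemma gammaXY_bihomogeneous {m n : ℕ} {p : Poly4}
    (hp : IsWeightedHomogeneous biweight p (m, n)) :
    IsWeightedHomogeneous biweight (gammaXY p) (m + 1, n + 1) := by
  have h : ∀ i j : Fin 2, IsWeightedHomogeneous biweight
      (X (Sum.inl i) * X (Sum.inr j) : Poly4) (1, 1) := fun i j =>
    (isWeightedHomogeneous_X ℂ biweight (Sum.inl i)).mul
      (isWeightedHomogeneous_X ℂ biweight (Sum.inr j))
  have h1 := ((h 0 1).sub (mul_comm (X (Sum.inl 1)) (X (Sum.inr 0) : Poly4) ▸ h 1 0)).mul hp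
  have h3 : ((1, 1) : ℕ × ℕ) + (m, n) = (m + 1, n + 1) := by simp [add_comm]
  rwa [h3] at h1

lemma deltaYX_pow_bihomogeneous (k : ℕ) : ∀ {m n : ℕ} {p : Poly4},
    IsWeightedHomogeneous biweight p (m + k, n) →
    IsWeightedHomogeneous biweight ((deltaYX ^ k) p) (m, n + k) := by
  induction k with
  | zero => intro m n p hp; exact hp
  | succ k ih =>
    intro m n p hp
    rw [pow_succ, Module.End.mul_apply]
    have := ih (m := m) (n := n + 1) (deltaYX_bihomogeneous (m := m + k) hp)
    rwa [show n + (k + 1) = n + 1 + k by omega]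

lemma gammaXY_pow_bihomogeneous (k : ℕ) {m n : ℕ} {p : Poly4}
    (hp : IsWeightedHomogeneous biweight p (m, n)) :
    IsWeightedHomogeneous biweight ((gammaXY ^ k) p) (m + k, n + k) := by
  induction k with
  | zero => exact hp
  | succ k ih =>
    rw [pow_succ', Module.End.mul_apply]
    exact gammaXY_bihomogeneous ih

/-- Under the embedding `P m ⊗ P n → ℂ[x, y]`, the vector `α_{m,n,h} f` is the polynomial
`√c_{m,n,h} Γ^h Δ_{yx}^{n-h} f(x₁, x₂)`. -/
lemma tensorToPoly_alpha {m n h r : ℕ} (hh : h ≤ min m n) (hr : r + 2 * h = m + n) (f : P r) :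
    tensorToPoly m n (alpha m n h r f) =
      ((√(cgCoeff m n h) : ℝ) : ℂ) • (gammaXY ^ h) ((deltaYX ^ (n - h)) (rename Sum.inl f.1)) := by
  rw [le_min_iff] at hh
  have h0 := rename_inl_bihomogeneous f
  have hs : ((r, 0) : ℕ × ℕ) = ((m - h) + (n - h), 0) := by rw [Prod.mk.injEq]; omega
  rw [hs] at h0
  have h1 := gammaXY_pow_bihomogeneous h (deltaYX_pow_bihomogeneous (n - h) h0)
  rw [show m - h + h = m by omega, show 0 + (n - h) + h = n by omega] at h1
  rw [alpha, LinearMap.smul_apply, map_smul]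
  exact congrArg _ (tensorToPoly_polyToTensor h1)

/-- The map `Φ_{m,n,h} : End (P r) → End (P m)`, `A ↦ Tr_{P n}(α A α^*)` with `α = α_{m,n,h}`;
it is used only for `h ≤ min m n` and `r = m + n - 2h`. -/
def eposic (m n h r : ℕ) : (P r →ₗ[ℂ] P r) →ₗ[ℂ] (P m →ₗ[ℂ] P m) where
  toFun A := partialTrace (P m) (P n) (alpha m n h r ∘ₗ A ∘ₗ LinearMap.adjoint (alpha m n h r))
  map_add' A B := by simp [LinearMap.comp_add, LinearMap.add_comp]
  map_smul' c A := by simp [LinearMap.comp_smul, LinearMap.smul_comp]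

/-- The set `EC(r, m)` of all EPOSIC channels from `End (P r)` to `End (P m)`. -/
def EC (r m : ℕ) : Set ((P r →ₗ[ℂ] P r) →ₗ[ℂ] (P m →ₗ[ℂ] P m)) :=
  {Φ | ∃ n h : ℕ, h ≤ min m n ∧ r + 2 * h = m + n ∧ Φ = eposic m n h r}

/-! ### The irreducible subspaces of `P m ⊗ Conj (P r)` -/

/-- The element `g₀` of `SU(2)` with rows `(0, 1)` and `(-1, 0)`. -/
def g0 : SU2 := ⟨!![0, 1; -1, 0], by
  rw [Matrix.mem_specialUnitaryGroup_iff, Matrix.mem_unitaryGroup_iff]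
  constructor
  · ext i j
    fin_cases i <;> fin_cases j <;> simp [Matrix.mul_apply, Matrix.star_apply]
  · simp⟩

/-- The linear map `Θ_m : P m → Conj (P m)` that fixes the canonical basis. -/
def theta (m : ℕ) : P m →ₗ[ℂ] Conj (P m) :=
  (canonicalBasis m).toBasis.constr ℂ fun l => toConj (canonicalBasis m l)

/-- The map `J_m = Θ_m ρ_m(g₀) : P m → Conj (P m)`. -/
def J (m : ℕ) : P m →ₗ[ℂ] Conj (P m) := theta m ∘ₗ rho m g0

/-- The map `η_{m,r,l} = (I ⊗ J_r) α_{m,r,l} : P s → P m ⊗ Conj (P r)`; it is used only for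
`l ≤ min m r` and `s = m + r - 2l`. -/
def eta (m r l s : ℕ) : P s →ₗ[ℂ] P m ⊗[ℂ] Conj (P r) :=
  TensorProduct.map LinearMap.id (J r) ∘ₗ alpha m r l s

/-- The operator `q_{m,r,l} = η_{m,r,l} η_{m,r,l}^*` on `P m ⊗ Conj (P r)`. -/
def projQ (m r l s : ℕ) : (P m ⊗[ℂ] Conj (P r)) →ₗ[ℂ] (P m ⊗[ℂ] Conj (P r)) :=
  eta m r l s ∘ₗ LinearMap.adjoint (eta m r l s)

/-- The tensor product representation of `SU(2)` on `P m ⊗ Conj (P r)`. -/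
def tensorRep (m r : ℕ) : Representation ℂ SU2 (P m ⊗[ℂ] Conj (P r)) :=
  (rho m).tprod (conjRep (rho r))

end Eposic

end

open scoped TensorProduct ComplexConjugate

noncomputable section

namespace Eposic

open MvPolynomial

/-! A channel in Stinespring form `A ↦ Tr_L(T A T^*)` with `T : H → K ⊗ L` has Choi matrix `V V^*`,
where `V : Conj L → K ⊗ Conj H` has the same matrix entries as `T` with two legs bent
(`choi_eq_reshuffle`). For `T = α_{m,n,h}` the bent map is equivariant, and `J n` identifies `P n`
with its conjugate, so `V ∘ J n` is an intertwining map from the irreducible `P n` to `P m ⊗ Conj (P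
r)`.

The target is multiplicity free. The maps `η_{m,r,l}` are equivariant isometries from irreducibles
of pairwise different dimensions, hence have orthogonal ranges by Schur's lemma, and these ranges
fill the space by a dimension count (`eq_zero_of_adjoint_eta_eq_zero`). This gives existence and
uniqueness of `W`, the projection `q = η η^*`, and `V ∘ J n = c • η`, hence `V V^* = |c|² q`.
Bending preserves the Hilbert-Schmidt norm, and `α`, `η`, `J` are isometric, so `|c|² (n + 1) = r +
1`.

That `α` is isometric follows, again by Schur, from its effect on the single vector `x₁ ^ r`, where
a closed form of `c_{m,n,h}` (`cgCoeff_eq`) meets a binomial sum (`sum_choose_mul_factorial`).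

For the count, the Choi matrix has rank `n + 1`, so for fixed `r` and `m` different `n` give
different channels, while `n` determines `h`. -/

/-! ### Powers of linear forms; irreducibility and unitarity of `ρ_m` -/

lemma rho_apply_coe (m : ℕ) (g : SU2) (f : P m) : (rho m g f).1 = subst g.1 f.1 := rfl

lemma eq_sum_mono {m : ℕ} (f : P m) : f = ∑ l : Fin (m + 1), coeff (expo m l) f.1 • mono m l := by
  refine P_ext fun k => ?_
  simp only [Submodule.coe_sum, Submodule.coe_smul, coeff_sum, coeff_smul, coeff_mono, smul_eq_mul]
  simp

lemma mono_ne_zero (m : ℕ) (l : Fin (m + 1)) : mono m l ≠ 0 := fun h => by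
  have := coeff_mono m l l
  rw [h] at this
  simp at this

/-- The power `(u₀ x₁ + u₁ x₂) ^ m` of a linear form. -/
def linPow (m : ℕ) (u : Fin 2 → ℂ) : P m :=
  ⟨(∑ i, C (u i) * X i) ^ m, by
    have h : (∑ i, C (u i) * X i : MvPolynomial (Fin 2) ℂ).IsHomogeneous 1 :=
      IsHomogeneous.sum _ _ _ fun i _ => (isHomogeneous_X ℂ i).C_mul _
    simpa using h.pow m⟩

lemma rho_linPow (m : ℕ) (g : SU2) (u : Fin 2 → ℂ) :
    rho m g (linPow m u) = linPow m (g.1.mulVec u) := by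
  apply Subtype.ext
  rw [rho_apply_coe]
  simp only [linPow, map_pow, subst, Fin.sum_univ_two, map_add, map_mul, aeval_X, algHom_C,
    algebraMap_eq, Matrix.mulVec, dotProduct]
  ring

lemma coeff_linPow (m : ℕ) (u : Fin 2 → ℂ) (k : Fin (m + 1)) :
    coeff (expo m k) (linPow m u).1 = (m.choose k : ℂ) * (u 0 ^ (k : ℕ) * u 1 ^ (m - k)) := by
  have : (linPow m u).1 = ∑ l : Fin (m + 1), monomial (expo m l)
      ((m.choose l : ℂ) * (u 0 ^ (l : ℕ) * u 1 ^ (m - l))) := by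
    change (∑ i, C (u i) * X i) ^ m = _
    rw [Fin.sum_univ_two, add_pow, ← Fin.sum_univ_eq_sum_range
      (fun l => (C (u 0) * X 0) ^ l * (C (u 1) * X 1) ^ (m - l) *
        (m.choose l : MvPolynomial (Fin 2) ℂ)) (m + 1)]
    refine Finset.sum_congr rfl fun l _ => ?_
    rw [monomial_eq, expo, Finsupp.prod_add_index' (by simp) (fun _ _ _ => pow_add _ _ _),
      Finsupp.prod_single_index (by simp), Finsupp.prod_single_index (by simp)]
    simp only [C_mul, C_pow, map_natCast]
    ring
  rw [this, coeff_sum, Finset.sum_eq_single k]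
  · simp
  · intro b _ hb
    rw [coeff_monomial, if_neg]
    exact fun h => hb (Fin.ext (expo_injective m h))
  · simp

/-- The weight `l! (m - l)!` turns one of the two binomial coefficients into `m!`, and the binomial
theorem sums what is left. The result depends only on the scalar product of `u` and `v`, which is
why `ρ_m` is unitary. -/
lemma inner_linPow (m : ℕ) (u v : Fin 2 → ℂ) :
    inner ℂ (linPow m u) (linPow m v) = (m.factorial : ℂ) * (star u ⬝ᵥ v) ^ m := by
  rw [inner_eq, innerP]
  simp only [coeff_linPow, dotProduct, Fin.sum_univ_two, Pi.star_apply]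
  rw [add_pow, ← Fin.sum_univ_eq_sum_range
      (fun l => (star (u 0) * v 0) ^ l * (star (u 1) * v 1) ^ (m - l) * (m.choose l : ℂ)) (m + 1),
    Finset.mul_sum]
  refine Finset.sum_congr rfl fun l _ => ?_
  have h := Nat.choose_mul_factorial_mul_factorial (Nat.lt_succ_iff.1 l.2)
  rw [← h]
  simp only [map_mul, map_pow, Complex.conj_natCast, ← starRingEnd_apply]
  push_cast
  ring

/-- The diagonal element of `SU(2)` with eigenvalues `t`, `conj t`. -/
def torus (t : ℂ) (ht : ‖t‖ = 1) : SU2 := ⟨!![t, 0; 0, conj t], by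
  have h : t * conj t = 1 := by rw [Complex.mul_conj']; simp [ht]
  have h' : conj t * t = 1 := by rw [mul_comm, h]
  rw [Matrix.mem_specialUnitaryGroup_iff, Matrix.mem_unitaryGroup_iff]
  constructor
  · ext i j
    fin_cases i <;> fin_cases j <;> simp [Matrix.mul_apply, Matrix.star_apply, h, h']
  · simp [h]⟩

lemma subst_mono (m : ℕ) (g : Matrix (Fin 2) (Fin 2) ℂ) (l : Fin (m + 1)) :
    subst g (mono m l).1 = (C (g 0 0) * X 0 + C (g 1 0) * X 1) ^ (l : ℕ) *
      (C (g 0 1) * X 0 + C (g 1 1) * X 1) ^ (m - l) := by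
  change subst g (monomial (expo m l) 1) = _
  rw [monomial_eq, expo, Finsupp.prod_add_index' (by simp) (fun _ _ _ => pow_add _ _ _),
      Finsupp.prod_single_index (by simp), Finsupp.prod_single_index (by simp)]
  simp [subst, Fin.sum_univ_two]

lemma mono_eq (m : ℕ) (l : Fin (m + 1)) :
    (mono m l).1 = (X 0 ^ (l : ℕ) * X 1 ^ (m - l) : MvPolynomial (Fin 2) ℂ) := by
  simpa [subst_one] using subst_mono m 1 l

lemma rho_torus_mono (m : ℕ) (t : ℂ) (ht : ‖t‖ = 1) (l : Fin (m + 1)) :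
    rho m (torus t ht) (mono m l) = (t ^ (l : ℕ) * conj t ^ (m - l)) • mono m l := by
  apply Subtype.ext
  rw [rho_apply_coe, subst_mono, Submodule.coe_smul, mono_eq, smul_eq_C_mul]
  simp only [torus, Matrix.of_apply, Matrix.cons_val', Matrix.cons_val_zero, Matrix.cons_val_one,
    Matrix.cons_val_fin_one, C_0, C_mul, C_pow]
  ring

lemma aeval_apply_mem {V : Type*} [AddCommGroup V] [Module ℂ V] (T : Module.End ℂ V)
    (U : Submodule ℂ V) (hU : ∀ f ∈ U, T f ∈ U) (p : Polynomial ℂ) {f : V} (hf : f ∈ U) :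
    Polynomial.aeval T p f ∈ U := by
  have hpow : ∀ n : ℕ, (T ^ n) f ∈ U := by
    intro n
    induction n with
    | zero => simpa using hf
    | succ n ih => rw [pow_succ']; exact hU _ ih
  rw [Polynomial.aeval_eq_sum_range, LinearMap.sum_apply]
  exact U.sum_mem fun i _ => U.smul_mem _ (hpow i)

/-- Some element of the diagonal torus acts on the monomials with distinct eigenvalues. -/
lemma exists_torus_injective (m : ℕ) : ∃ (t : ℂ) (_ : ‖t‖ = 1),
    Function.Injective fun k : Fin (m + 1) => t ^ (k : ℕ) * conj t ^ (m - k) := by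
  -- The eigenvalues are `t ^ (2k - m)`. After multiplication by `t ^ m` the exponents are `2k` with
  -- `2k < 2(m + 1)`, so a primitive root of order `2(m + 1)` separates them.
  obtain ⟨t, hprim⟩ : ∃ t : ℂ, IsPrimitiveRoot t (2 * (m + 1)) :=
    ⟨_, Complex.isPrimitiveRoot_exp (2 * (m + 1)) (by omega)⟩
  have ht : ‖t‖ = 1 := hprim.norm'_eq_one (by omega)
  have htc : t * conj t = 1 := by rw [Complex.mul_conj']; simp [ht]
  have key : ∀ k : Fin (m + 1), t ^ (k : ℕ) * conj t ^ (m - k) * t ^ m = t ^ (2 * (k : ℕ)) := by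
    intro k
    have : t ^ m = t ^ (k : ℕ) * t ^ (m - k) := by rw [← pow_add]; congr 1; omega
    calc t ^ (k : ℕ) * conj t ^ (m - k) * t ^ m
        = t ^ (k : ℕ) * t ^ (k : ℕ) * (t * conj t) ^ (m - k) := by rw [this]; ring
      _ = _ := by rw [htc, one_pow, mul_one, two_mul, pow_add]
  refine ⟨t, ht, fun a b hab => ?_⟩
  have h1 : t ^ (2 * (a : ℕ)) = t ^ (2 * (b : ℕ)) := by
    rw [← key, ← key]
    exact congrArg (· * t ^ m) hab
  have := hprim.pow_inj (by omega) (by omega) h1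
  exact Fin.ext (by omega)

/-- A subspace of `P m` stable under an operator that acts on the monomials with distinct
eigenvalues contains every monomial that occurs in one of its elements. -/
lemma mono_mem_of_diagonal {m : ℕ} (U : Submodule ℂ (P m)) (T : Module.End ℂ (P m))
    (hU : ∀ f ∈ U, T f ∈ U) {χ : Fin (m + 1) → ℂ} (hχ : Function.Injective χ)
    (hT : ∀ k, T (mono m k) = χ k • mono m k) {f : P m} (hf : f ∈ U) (l : Fin (m + 1))
    (hl : coeff (expo m l) f.1 ≠ 0) : mono m l ∈ U := by
  -- The Lagrange polynomial at the node `χ l`, evaluated at `T`, is the projection onto the line of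
  -- `mono m l`. Being a polynomial in `T`, it preserves `U`.
  have hp : ∀ k, Polynomial.aeval T (Lagrange.basis Finset.univ χ l) (mono m k) =
      (if k = l then 1 else 0 : ℂ) • mono m k := by
    intro k
    have he : T.HasEigenvector (χ k) (mono m k) :=
      ⟨Module.End.mem_eigenspace_iff.2 (hT k), mono_ne_zero m k⟩
    rw [Module.End.aeval_apply_of_hasEigenvector he]
    split_ifs with h
    · subst h
      rw [Lagrange.eval_basis_self hχ.injOn (Finset.mem_univ _)]
    · rw [Lagrange.eval_basis_of_ne (Ne.symm h) (Finset.mem_univ _)]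
  have hmem := aeval_apply_mem T U hU (Lagrange.basis Finset.univ χ l) hf
  rw [eq_sum_mono f, map_sum, Finset.sum_eq_single l, map_smul, hp, if_pos rfl, one_smul] at hmem
  · exact (U.smul_mem_iff hl).1 hmem
  · intro b _ hb
    rw [map_smul, hp, if_neg hb, zero_smul, smul_zero]
  · simp

lemma mono_mem_of_coeff_ne_zero {m : ℕ} (U : Submodule ℂ (P m))
    (hU : ∀ g : SU2, ∀ f ∈ U, rho m g f ∈ U) {f : P m} (hf : f ∈ U) (l : Fin (m + 1))
    (hl : coeff (expo m l) f.1 ≠ 0) : mono m l ∈ U := by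
  obtain ⟨t, ht, hχ⟩ := exists_torus_injective m
  exact mono_mem_of_diagonal U _ (hU (torus t ht)) hχ (rho_torus_mono m t ht) hf l hl

/-- A rotation in `SU(2)` without zero entries. -/
def rotation : SU2 := ⟨!![3/5, -4/5; 4/5, 3/5], by
  rw [Matrix.mem_specialUnitaryGroup_iff, Matrix.mem_unitaryGroup_iff]
  constructor
  · ext i j
    fin_cases i <;> fin_cases j <;>
      simp [Matrix.mul_apply, Matrix.star_apply, map_ofNat (starRingEnd ℂ)] <;> norm_num
  · simp; norm_num⟩

/-- Reading the coefficient of `x₁ ^ m` as a value at `(1, 0)` avoids expanding a rotated monomial.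
-/
lemma coeff_last_eq_eval {m : ℕ} (f : P m) :
    coeff (expo m (Fin.last m)) f.1 = eval ![1, 0] f.1 := by
  conv_rhs => rw [eq_sum_mono f]
  simp only [Submodule.coe_sum, Submodule.coe_smul, mono_eq, map_sum, smul_eval, map_mul, map_pow,
    eval_X]
  rw [Finset.sum_eq_single (Fin.last m)]
  · simp
  · intro b _ hb
    have : (b : ℕ) ≠ m := fun h => hb (Fin.ext h)
    have h2 : m - (b : ℕ) ≠ 0 := by omega
    simp [h2]
  · simp

lemma mono_last (m : ℕ) : mono m (Fin.last m) = linPow m ![1, 0] := by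
  apply Subtype.ext
  rw [mono_eq]
  simp [linPow, Fin.sum_univ_two]

/-- A nonzero invariant subspace of `P m` is everything. -/
lemma eq_top_of_invariant {m : ℕ} (U : Submodule ℂ (P m))
    (hU : ∀ g : SU2, ∀ f ∈ U, rho m g f ∈ U) (h0 : U ≠ ⊥) : U = ⊤ := by
  obtain ⟨f, hf, hf0⟩ := U.ne_bot_iff.1 h0
  obtain ⟨l, hl⟩ : ∃ l : Fin (m + 1), coeff (expo m l) f.1 ≠ 0 := by
    by_contra! h
    exact hf0 (P_ext fun l => by simpa using h l)
  -- The rotated monomial takes at `(1, 0)` a product of powers of entries of the rotation, which is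
  -- nonzero. So `x₁ ^ m` occurs in it.
  have h1 := hU rotation _ (mono_mem_of_coeff_ne_zero U hU hf l hl)
  have h2 : mono m (Fin.last m) ∈ U := by
    refine mono_mem_of_coeff_ne_zero U hU h1 _ ?_
    rw [coeff_last_eq_eval, rho_apply_coe, subst_mono]
    simp [rotation]
  rw [eq_top_iff]
  intro v _
  rw [eq_sum_mono v]
  refine U.sum_mem fun k _ => U.smul_mem _ ?_
  -- The rotation sends `x₁ ^ m` to the power of a linear form with both coefficients nonzero, in
  -- which every monomial occurs.
  refine mono_mem_of_coeff_ne_zero U hU (hU rotation _ h2) k ?_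
  rw [mono_last, rho_linPow, coeff_linPow]
  have hk : m.choose k ≠ 0 := (Nat.choose_pos (Nat.lt_succ_iff.1 k.2)).ne'
  simp [rotation, Matrix.mulVec, dotProduct, hk]

/-- The span is invariant and contains `x₁ ^ m`. Sesquilinear identities on `P m` can thus be tested
on powers of linear forms. -/
lemma span_linPow (m : ℕ) : Submodule.span ℂ (Set.range (linPow m)) = ⊤ := by
  refine eq_top_of_invariant _ (fun g f hf => ?_) fun h => ?_
  · induction hf using Submodule.span_induction with
    | mem x hx =>
      obtain ⟨u, rfl⟩ := hx
      rw [rho_linPow]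
      exact Submodule.subset_span ⟨_, rfl⟩
    | zero => simp
    | add x y _ _ hx hy => rw [map_add]; exact Submodule.add_mem _ hx hy
    | smul a x _ hx => rw [map_smul]; exact Submodule.smul_mem _ _ hx
  · rw [Submodule.span_eq_bot] at h
    exact mono_ne_zero m (Fin.last m) (mono_last m ▸ h _ ⟨_, rfl⟩)

lemma inner_rho_rho (m : ℕ) (g : SU2) (f f' : P m) :
    inner ℂ (rho m g f) (rho m g f') = inner ℂ f f' := by
  have hg : g.1.conjTranspose * g.1 = 1 :=
    Matrix.mem_unitaryGroup_iff'.1 (Matrix.mem_specialUnitaryGroup_iff.1 g.2).1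
  have hf : f ∈ Submodule.span ℂ (Set.range (linPow m)) := by simp [span_linPow]
  have hf' : f' ∈ Submodule.span ℂ (Set.range (linPow m)) := by simp [span_linPow]
  induction hf using Submodule.span_induction with
  | mem x hx =>
    obtain ⟨u, rfl⟩ := hx
    induction hf' using Submodule.span_induction with
    | mem y hy =>
      obtain ⟨v, rfl⟩ := hy
      rw [rho_linPow, rho_linPow, inner_linPow, inner_linPow, Matrix.star_mulVec,
        ← Matrix.dotProduct_mulVec, Matrix.mulVec_mulVec, hg, Matrix.one_mulVec]
    | zero => simp
    | add x y _ _ hx hy => rw [map_add, inner_add_right, inner_add_right, hx, hy]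
    | smul a x _ hx => rw [map_smul, inner_smul_right, inner_smul_right, hx]
  | zero => simp
  | add x y _ _ hx hy => rw [map_add, inner_add_left, inner_add_left, hx, hy]
  | smul a x _ hx => rw [map_smul, inner_smul_left, inner_smul_left, hx]

lemma inner_rho_left (m : ℕ) (g : SU2) (f f' : P m) :
    inner ℂ (rho m g f) f' = inner ℂ f (rho m g⁻¹ f') := by
  rw [← inner_rho_rho m g f, Representation.self_inv_apply]

instance isIrreducible_rho (m : ℕ) : (rho m).IsIrreducible where
  exists_pair_ne := ⟨⊥, ⊤, fun h => by
    have := congrArg Subrepresentation.toSubmodule h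
    have h2 : (mono m 0) ∈ (⊥ : Submodule ℂ (P m)) := by
      change (⊥ : Submodule ℂ (P m)) = ⊤ at this
      rw [this]; trivial
    exact mono_ne_zero m 0 h2⟩
  eq_bot_or_eq_top U := by
    by_cases h : U.toSubmodule = ⊥
    · exact Or.inl (Subrepresentation.toSubmodule_injective h)
    · refine Or.inr (Subrepresentation.toSubmodule_injective ?_)
      exact eq_top_of_invariant _ (fun g f hf => U.apply_mem_toSubmodule g hf) h

lemma finrank_P (m : ℕ) : Module.finrank ℂ (P m) = m + 1 := by
  simp [Module.finrank_eq_card_basis (canonicalBasis m).toBasis]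

/-! ### Equivariance of `α` -/

/-- The simultaneous substitution `x ↦ x g`, `y ↦ y g` in polynomials in `x` and `y`. -/
def substXY (g : Matrix (Fin 2) (Fin 2) ℂ) : Poly4 →ₐ[ℂ] Poly4 :=
  aeval (Sum.elim (fun j => ∑ i, C (g i j) * X (Sum.inl i)) fun j => ∑ i, C (g i j) * X (Sum.inr i))

lemma substXY_rename_inl (g : Matrix (Fin 2) (Fin 2) ℂ) (f : MvPolynomial (Fin 2) ℂ) :
    substXY g (rename Sum.inl f) = rename Sum.inl (subst g f) := by
  suffices h : (substXY g).comp (rename Sum.inl) = (rename Sum.inl).comp (subst g) from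
    DFunLike.congr_fun h f
  refine MvPolynomial.algHom_ext fun i => ?_
  simp [substXY, subst]

lemma substXY_rename_inr (g : Matrix (Fin 2) (Fin 2) ℂ) (f : MvPolynomial (Fin 2) ℂ) :
    substXY g (rename Sum.inr f) = rename Sum.inr (subst g f) := by
  suffices h : (substXY g).comp (rename Sum.inr) = (rename Sum.inr).comp (subst g) from
    DFunLike.congr_fun h f
  refine MvPolynomial.algHom_ext fun i => ?_
  simp [substXY, subst]

lemma tensorToPoly_map_rho (m n : ℕ) (g : SU2) (z : P m ⊗[ℂ] P n) :
    tensorToPoly m n (TensorProduct.map (rho m g) (rho n g) z) =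
      substXY g.1 (tensorToPoly m n z) := by
  induction z with
  | zero => simp
  | add x y hx hy => simp only [map_add, hx, hy]
  | tmul f f' =>
    rw [TensorProduct.map_tmul, tensorToPoly_tmul, tensorToPoly_tmul, map_mul, substXY_rename_inl,
      substXY_rename_inr]
    rfl

lemma tensorToPoly_injective (m n : ℕ) : Function.Injective (tensorToPoly m n) :=
  Function.LeftInverse.injective (polyToTensor_tensorToPoly m n)

lemma gammaXY_apply (p : Poly4) : gammaXY p =
    (X (Sum.inl 0) * X (Sum.inr 1) - X (Sum.inr 0) * X (Sum.inl 1)) * p := rfl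

lemma deltaYX_apply (p : Poly4) : deltaYX p =
    X (Sum.inr 0) * pderiv (Sum.inl 0) p + X (Sum.inr 1) * pderiv (Sum.inl 1) p := rfl

/-- The factor `x₁ y₂ - y₁ x₂` is a determinant, so the substitution multiplies it by `det g = 1`.
-/
lemma substXY_gammaXY (g : SU2) (p : Poly4) :
    substXY g.1 (gammaXY p) = gammaXY (substXY g.1 p) := by
  have hdet : C (g.1 0 0) * C (g.1 1 1) - C (g.1 0 1) * C (g.1 1 0) = (1 : Poly4) := by
    rw [← C_mul, ← C_mul, ← C_sub, ← Matrix.det_fin_two,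
      (Matrix.mem_specialUnitaryGroup_iff.1 g.2).2, C_1]
  simp only [gammaXY_apply, map_mul, map_sub]
  congr 1
  simp only [substXY, aeval_X, Sum.elim_inl, Sum.elim_inr, Fin.sum_univ_two]
  linear_combination (X (Sum.inl 0) * X (Sum.inr 1) - X (Sum.inr 0) * X (Sum.inl 1)) * hdet

lemma deltaYX_mul (p q : Poly4) : deltaYX (p * q) = deltaYX p * q + p * deltaYX q := by
  simp only [deltaYX_apply, Derivation.leibniz, smul_eq_mul]
  ring

lemma deltaYX_C_mul (a : ℂ) (q : Poly4) : deltaYX (C a * q) = C a * deltaYX q := by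
  rw [← smul_eq_C_mul, ← smul_eq_C_mul, map_smul]

lemma deltaYX_X_inl (j : Fin 2) : deltaYX (X (Sum.inl j)) = X (Sum.inr j) := by
  rw [deltaYX_apply, pderiv_X, pderiv_X]
  fin_cases j <;> simp

lemma deltaYX_X_inr (j : Fin 2) : deltaYX (X (Sum.inr j)) = 0 := by
  rw [deltaYX_apply, pderiv_X, pderiv_X]
  simp

lemma substXY_X_inl (g : Matrix (Fin 2) (Fin 2) ℂ) (j : Fin 2) :
    substXY g (X (Sum.inl j)) = ∑ i, C (g i j) * X (Sum.inl i) := by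
  rw [substXY, aeval_X]
  rfl

lemma substXY_X_inr (g : Matrix (Fin 2) (Fin 2) ℂ) (j : Fin 2) :
    substXY g (X (Sum.inr j)) = ∑ i, C (g i j) * X (Sum.inr i) := by
  rw [substXY, aeval_X]
  rfl

/-- Since `Δ` is a derivation, the variables suffice. There `Δ` sends `x_j` to `y_j` and `y_j` to
`0`, and `g` mixes the `x`'s and the `y`'s by the same matrix. -/
lemma substXY_deltaYX (g : Matrix (Fin 2) (Fin 2) ℂ) (p : Poly4) :
    substXY g (deltaYX p) = deltaYX (substXY g p) := by
  induction p using MvPolynomial.induction_on with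
  | C a => simp [deltaYX_apply]
  | add p q hp hq => simp only [map_add, hp, hq]
  | mul_X p i hp =>
    suffices h : substXY g (deltaYX (X i)) = deltaYX (substXY g (X i)) by
      rw [deltaYX_mul, map_add, map_mul, map_mul, hp, h, map_mul, deltaYX_mul]
    rcases i with j | j
    · rw [deltaYX_X_inl, substXY_X_inl, substXY_X_inr, map_sum]
      simp only [deltaYX_C_mul, deltaYX_X_inl]
    · rw [deltaYX_X_inr, substXY_X_inr, map_sum]
      simp only [deltaYX_C_mul, deltaYX_X_inr, mul_zero, Finset.sum_const_zero, map_zero]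

/-- The map `α_{m,n,h}` intertwines `ρ_r` and `ρ_m ⊗ ρ_n`. -/
lemma alpha_rho {m n h r : ℕ} (hh : h ≤ min m n) (hr : r + 2 * h = m + n) (g : SU2) (f : P r) :
    alpha m n h r (rho r g f) = TensorProduct.map (rho m g) (rho n g) (alpha m n h r f) := by
  have hd : ∀ (k : ℕ) (p : Poly4),
      (deltaYX ^ k) (substXY g.1 p) = substXY g.1 ((deltaYX ^ k) p) := by
    intro k
    induction k with
    | zero => intro p; rfl
    | succ k ih =>
      intro p
      rw [pow_succ, Module.End.mul_apply, Module.End.mul_apply, ← substXY_deltaYX, ih]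
  have hg : ∀ (k : ℕ) (p : Poly4),
      (gammaXY ^ k) (substXY g.1 p) = substXY g.1 ((gammaXY ^ k) p) := by
    intro k
    induction k with
    | zero => intro p; rfl
    | succ k ih =>
      intro p
      rw [pow_succ, Module.End.mul_apply, Module.End.mul_apply, ← substXY_gammaXY, ih]
  apply tensorToPoly_injective
  rw [tensorToPoly_map_rho, tensorToPoly_alpha hh hr, tensorToPoly_alpha hh hr, map_smul,
    rho_apply_coe, ← substXY_rename_inl, hd, hg]

/-! ### The map `J` -/

/-- Complex conjugation of the coefficients. -/
def conjP (m : ℕ) (f : P m) : P m :=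
  ⟨map (starRingEnd ℂ) f.1, (mem_homogeneousSubmodule _ _).2
    (((mem_homogeneousSubmodule _ _).1 f.2).map _)⟩

lemma conjP_conjP (m : ℕ) (f : P m) : conjP m (conjP m f) = f := by
  apply Subtype.ext
  ext d
  change coeff d (map _ (map _ f.1)) = _
  rw [coeff_map, coeff_map, Complex.conj_conj]

lemma inner_conjP (m : ℕ) (f f' : P m) : inner ℂ (conjP m f) (conjP m f') = inner ℂ f' f := by
  rw [inner_eq, inner_eq, innerP, innerP]
  refine Finset.sum_congr rfl fun l _ => ?_
  simp only [conjP, coeff_map, Complex.conj_conj]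
  ring

/-- Conjugation of coefficients is linear as a map into the conjugate space, and it fixes the
canonical basis because that basis has real coefficients. -/
lemma theta_apply (m : ℕ) (f : P m) : theta m f = toConj (conjP m f) := by
  let F : P m →ₗ[ℂ] Conj (P m) :=
    { toFun := fun f => toConj (conjP m f)
      map_add' := fun f f' => by
        rw [← map_add]
        refine congrArg _ (Subtype.ext ?_)
        simp [conjP]
      map_smul' := fun c f => by
        rw [RingHom.id_apply, smul_toConj]
        refine congrArg _ (Subtype.ext ?_)
        ext d
        change coeff d (map _ (c • f.1)) = coeff d (conj c • map _ f.1)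
        rw [coeff_map, coeff_smul, coeff_smul, coeff_map, smul_eq_mul, smul_eq_mul, map_mul] }
  suffices h : theta m = F from DFunLike.congr_fun h f
  apply (canonicalBasis m).toBasis.ext
  intro l
  rw [theta, Module.Basis.constr_basis]
  change _ = toConj (conjP m ((canonicalBasis m).toBasis l))
  rw [OrthonormalBasis.coe_toBasis, canonicalBasis_apply]
  refine congrArg _ (P_ext fun k => ?_)
  change _ = coeff _ (map _ _)
  rw [coeff_map, canonicalVec_coeff]
  split_ifs <;> simp

lemma J_apply (m : ℕ) (f : P m) : J m f = toConj (conjP m (rho m g0 f)) := theta_apply _ _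

lemma inner_J (m : ℕ) (f f' : P m) : inner ℂ (J m f) (J m f') = inner ℂ f f' := by
  rw [J_apply, J_apply, inner_toConj, inner_conjP, inner_rho_rho]

lemma J_surjective (m : ℕ) : Function.Surjective (J m) := fun v =>
  ⟨rho m g0⁻¹ (conjP m (toConj.symm v)), by
    rw [J_apply, Representation.self_inv_apply, conjP_conjP]
    exact toConj.apply_symm_apply v⟩

/-- `J m` as a unitary map. -/
def unitaryJ (m : ℕ) : P m ≃ₗᵢ[ℂ] Conj (P m) :=
  LinearIsometryEquiv.ofSurjective ((J m).isometryOfInner (inner_J m)) (J_surjective m)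

lemma map_subst (g : Matrix (Fin 2) (Fin 2) ℂ) (f : MvPolynomial (Fin 2) ℂ) :
    map (starRingEnd ℂ) (subst g f) = subst (g.map (starRingEnd ℂ)) (map (starRingEnd ℂ) f) := by
  induction f using MvPolynomial.induction_on with
  | C a => simp [algHom_C]
  | add p q hp hq => simp only [map_add, hp, hq]
  | mul_X p i hp =>
    rw [map_mul, map_mul, hp, map_mul, map_mul]
    simp [subst]

/-- In `SU(2)` the conjugate transpose and the adjugate are both the inverse. Comparing their
entries shows that conjugation by `g₀` is entrywise complex conjugation, which makes `ρ_m`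
equivalent to its conjugate. -/
lemma g0_mul (g : SU2) : g0.1 * g.1 = g.1.map (starRingEnd ℂ) * g0.1 := by
  have h1 : g.1.conjTranspose = g.1.adjugate := by
    have ha : g.1.conjTranspose * g.1 = 1 :=
      Matrix.mem_unitaryGroup_iff'.1 (Matrix.mem_specialUnitaryGroup_iff.1 g.2).1
    have hb : g.1 * g.1.adjugate = 1 := by
      rw [Matrix.mul_adjugate, (Matrix.mem_specialUnitaryGroup_iff.1 g.2).2, one_smul]
    exact left_inv_eq_right_inv ha hb
  rw [Matrix.adjugate_fin_two] at h1
  have h00 := congrFun (congrFun h1 0) 0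
  have h01 := congrFun (congrFun h1 0) 1
  have h10 := congrFun (congrFun h1 1) 0
  have h11 := congrFun (congrFun h1 1) 1
  simp only [Matrix.conjTranspose_apply, Matrix.of_apply, Matrix.cons_val', Matrix.cons_val_zero,
    Matrix.cons_val_one, Matrix.cons_val_fin_one, ← starRingEnd_apply] at h00 h01 h10 h11
  ext i j
  fin_cases i <;> fin_cases j <;> simp [g0, Matrix.mul_apply, h00, h01, h10, h11]

lemma conjRep_toConj (m : ℕ) (g : SU2) (f : P m) :
    conjRep (rho m) g (toConj f) = toConj (rho m g f) := rfl

/-- The map `J m` intertwines `ρ_m` and its conjugate. -/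
lemma J_rho (m : ℕ) (g : SU2) (f : P m) : J m (rho m g f) = conjRep (rho m) g (J m f) := by
  rw [J_apply, J_apply, conjRep_toConj]
  refine congrArg _ (Subtype.ext ?_)
  change map (starRingEnd ℂ) (subst g0.1 (subst g.1 f.1)) =
    subst g.1 (map (starRingEnd ℂ) (subst g0.1 f.1))
  have hg : g.1 = (g.1.map (starRingEnd ℂ)).map (starRingEnd ℂ) := by
    ext i j
    simp
  conv_rhs => rw [hg, ← map_subst]
  rw [← AlgHom.comp_apply, ← AlgHom.comp_apply, ← subst_mul, ← subst_mul, g0_mul]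

/-! ### Unitary representations and Schur's lemma -/

section Unitary

variable {G H K : Type*} [Group G] [NormedAddCommGroup H] [InnerProductSpace ℂ H]
  [NormedAddCommGroup K] [InnerProductSpace ℂ K]

/-- A representation by unitary operators. -/
def IsUnitaryRep (π : Representation ℂ G H) : Prop :=
  ∀ g v w, inner ℂ (π g v) w = inner ℂ v (π g⁻¹ w)

lemma IsUnitaryRep.tprod {π : Representation ℂ G H} {σ : Representation ℂ G K}
    (hπ : IsUnitaryRep π) (hσ : IsUnitaryRep σ) : IsUnitaryRep (π.tprod σ) := by
  intro g x y
  simp only [Representation.tprod_apply]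
  induction x with
  | zero => simp
  | add x x' hx hx' => rw [map_add, inner_add_left, inner_add_left, hx, hx']
  | tmul v w =>
    induction y with
    | zero => simp
    | add y y' hy hy' => rw [map_add, inner_add_right, inner_add_right, hy, hy']
    | tmul v' w' =>
      rw [TensorProduct.map_tmul, TensorProduct.map_tmul, TensorProduct.inner_tmul,
        TensorProduct.inner_tmul, hπ, hσ]

lemma IsUnitaryRep.conj {π : Representation ℂ G H} (hπ : IsUnitaryRep π) :
    IsUnitaryRep (conjRep π) := by
  intro g v w
  have h := hπ g⁻¹ (toConj.symm w) (toConj.symm v)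
  rw [inv_inv] at h
  exact h.symm

lemma IsUnitaryRep.adjoint_apply [FiniteDimensional ℂ H] [FiniteDimensional ℂ K]
    {π : Representation ℂ G H} {σ : Representation ℂ G K} (hπ : IsUnitaryRep π)
    (hσ : IsUnitaryRep σ) {T : H →ₗ[ℂ] K} (hT : ∀ g v, T (π g v) = σ g (T v)) (g : G) (w : K) :
    LinearMap.adjoint T (σ g w) = π g (LinearMap.adjoint T w) := by
  refine ext_inner_right ℂ fun v => ?_
  rw [LinearMap.adjoint_inner_left, hσ, ← hT, hπ, LinearMap.adjoint_inner_left]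

end Unitary

lemma isUnitaryRep_rho (m : ℕ) : IsUnitaryRep (rho m) := inner_rho_left m

instance nontrivial_P (m : ℕ) : Nontrivial (P m) := ⟨⟨mono m 0, 0, mono_ne_zero m 0⟩⟩

/-- Schur's lemma: an eigenspace of `A` is invariant and nonzero, hence everything. -/
lemma exists_eq_smul_of_commute {r : ℕ} (A : P r →ₗ[ℂ] P r)
    (hA : ∀ g f, A (rho r g f) = rho r g (A f)) : ∃ c : ℂ, ∀ f, A f = c • f := by
  obtain ⟨c, hc⟩ := Module.End.exists_eigenvalue A
  refine ⟨c, fun f => ?_⟩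
  have h : Module.End.eigenspace A c = ⊤ := eq_top_of_invariant _ (fun g f hf => by
    rw [Module.End.mem_eigenspace_iff] at hf ⊢
    rw [hA, hf, map_smul]) hc
  exact Module.End.mem_eigenspace_iff.1 (h ▸ Submodule.mem_top)

/-- An intertwining map into a unitary representation that preserves the norm of one nonzero vector
is isometric. -/
lemma inner_map_map_of_intertwining {r : ℕ} {K : Type*} [NormedAddCommGroup K]
    [InnerProductSpace ℂ K] [FiniteDimensional ℂ K] {σ : Representation ℂ SU2 K}
    (hσ : IsUnitaryRep σ) {T : P r →ₗ[ℂ] K} (hT : ∀ g f, T (rho r g f) = σ g (T f)) {f₀ : P r}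
    (hf₀ : f₀ ≠ 0) (h₀ : inner ℂ (T f₀) (T f₀) = inner ℂ f₀ f₀) (f f' : P r) :
    inner ℂ (T f) (T f') = inner ℂ f f' := by
  obtain ⟨c, hc⟩ := exists_eq_smul_of_commute (LinearMap.adjoint T ∘ₗ T) fun g f => by
    rw [LinearMap.comp_apply, hT, (isUnitaryRep_rho r).adjoint_apply hσ hT, LinearMap.comp_apply]
  have key : ∀ f f', inner ℂ (T f) (T f') = c * inner ℂ f f' := fun f f' => by
    rw [← LinearMap.adjoint_inner_right, ← LinearMap.comp_apply, hc, inner_smul_right]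
  have hc1 : c = 1 := by
    rw [key] at h₀
    exact (mul_eq_right₀ (inner_self_ne_zero.2 hf₀)).1 h₀
  rw [key, hc1, one_mul]

/-! ### The Clebsch-Gordan coefficients and the norm of `α` -/

open Nat in
-- Writing `m = a + h` and `n = b + h` removes all truncated subtractions. The recursion lowers `n`
-- but may raise `m`, so the induction is on `n = N` with `a`, `b`, `h` free. Its three cases are
-- those of the definition: `h = 0`, then `b = 0` (that is, `h = n`), then the generic one.
lemma cgCoeff_eq (N : ℕ) : ∀ a b h : ℕ, b + h = N → cgCoeff (a + h) (b + h) h =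
    (a + b + 1) * a ! / (h ! * b ! * (a + b + h + 1)!) := by
  induction N with
  | zero =>
    rintro a b h hN
    obtain ⟨rfl, rfl⟩ : b = 0 ∧ h = 0 := by omega
    rw [cgCoeff]
    have : ((a ! : ℕ) : ℝ) ≠ 0 := by positivity
    simp only [add_zero, Nat.factorial_zero, Nat.factorial_succ]
    push_cast
    field_simp
    ring
  | succ N ih =>
    rintro a b h hN
    have h1 : ((a ! : ℕ) : ℝ) ≠ 0 := by positivity
    have h2 : ((b ! : ℕ) : ℝ) ≠ 0 := by positivity
    have h3 : ((h ! : ℕ) : ℝ) ≠ 0 := by positivity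
    rcases h with _ | h
    · obtain ⟨b, rfl⟩ : ∃ b', b = b' + 1 := ⟨b - 1, by omega⟩
      have h4 : (((a + b + 1) ! : ℕ) : ℝ) ≠ 0 := by positivity
      have e := ih (a + 1) b 0 (by omega)
      simp only [add_zero] at e
      rw [add_zero, add_zero, cgCoeff, e, show a + 1 + b + 1 = a + b + 1 + 1 by ring,
        show a + (b + 1) + 0 + 1 = a + b + 1 + 1 by ring]
      simp only [Nat.factorial_zero, Nat.factorial_succ b, Nat.factorial_succ a,
        Nat.factorial_succ (a + b + 1)]
      simp only [Nat.factorial_succ b] at h2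
      push_cast
      field_simp
      ring
    · have e1 := ih a b h (by omega)
      have h5 : (((a + b + h + 1) ! : ℕ) : ℝ) ≠ 0 := by positivity
      have h3 : ((h ! : ℕ) : ℝ) ≠ 0 := by positivity
      rcases b with _ | b
      · rw [show 0 + (h + 1) = h + 1 by ring, show a + (h + 1) = a + h + 1 by ring, cgCoeff,
          if_neg (by omega), show a + h + 1 - 1 = a + h by omega]
        rw [zero_add] at e1
        rw [e1]
        simp only [add_zero] at h5 ⊢
        rw [show a + (h + 1) + 1 = a + h + 1 + 1 by ring]
        simp only [Nat.factorial_zero, Nat.factorial_succ h, Nat.factorial_succ (a + h + 1)]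
        push_cast
        field_simp
      · have e2 := ih (a + 1) b (h + 1) (by omega)
        rw [show b + 1 + (h + 1) = (b + 1 + h) + 1 by ring, show a + (h + 1) = a + h + 1 by ring,
          cgCoeff, if_pos (by omega), show a + h + 1 - 1 = a + h by omega, e1,
          show a + h + 1 + 1 = a + 1 + (h + 1) by ring, show b + 1 + h = b + (h + 1) by ring, e2]
        have h6 : (((a + b + h + 2) ! : ℕ) : ℝ) ≠ 0 := by positivity
        have h7 : ((b ! : ℕ) : ℝ) ≠ 0 := by positivity
        rw [show a + (b + 1) + h + 1 = a + b + h + 2 by ring,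
          show a + 1 + b + (h + 1) + 1 = a + b + h + 2 + 1 by ring,
          show a + (b + 1) + (h + 1) + 1 = a + b + h + 2 + 1 by ring]
        simp only [Nat.factorial_succ h, Nat.factorial_succ b, Nat.factorial_succ a,
          Nat.factorial_succ (a + b + h + 2)]
        push_cast
        field_simp
        ring

open Nat in
-- Divided by `(a + b + h + 1)!`, the terms are Beta integrals of `t ^ (a + j) (1 - t) ^ (b + h -
-- j)`, whose binomial sum is the Beta integral of `t ^ a (1 - t) ^ b`. The discrete form of this
-- argument is used: Pascal's rule splits the sum for `h + 1` into those for `(a, b + 1)` and `(a +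
-- 1, b)`.
lemma sum_choose_mul_factorial (h : ℕ) : ∀ a b : ℕ,
    (∑ j ∈ Finset.range (h + 1), (h.choose j : ℝ) * ((a + j)! * (b + h - j)! : ℕ)) =
      a ! * b ! * (a + b + h + 1)! / (a + b + 1)! := by
  induction h with
  | zero =>
    intro a b
    have : (((a + b + 1) ! : ℕ) : ℝ) ≠ 0 := by positivity
    simp [this]
  | succ h ih =>
    intro a b
    have e1 := ih a (b + 1)
    have e2 := ih (a + 1) b
    have hs : (∑ j ∈ Finset.range (h + 1 + 1),
        ((h + 1).choose j : ℝ) * ((a + j)! * (b + (h + 1) - j)! : ℕ)) =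
        (∑ j ∈ Finset.range (h + 1), (h.choose j : ℝ) * ((a + j)! * (b + 1 + h - j)! : ℕ)) +
        ∑ j ∈ Finset.range (h + 1), (h.choose j : ℝ) * ((a + 1 + j)! * (b + h - j)! : ℕ) := by
      -- An index shift: the last summand on the left vanishes because `h.choose (h + 1) = 0`, and
      -- the isolated term is the summand `j = 0` on the right.
      have e3 : ∑ j ∈ Finset.range (h + 1), (h.choose (j + 1) : ℝ) *
          ((a + (j + 1))! * (b + (h + 1) - (j + 1))! : ℕ) + (a ! * (b + (h + 1))! : ℕ) =
          ∑ j ∈ Finset.range (h + 1), (h.choose j : ℝ) * ((a + j)! * (b + 1 + h - j)! : ℕ) := by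
        rw [Finset.sum_range_succ, Finset.sum_range_succ' _ h, Nat.choose_succ_self]
        simp [add_comm, add_left_comm]
      rw [Finset.sum_range_succ', ← e3]
      simp only [Nat.choose_succ_succ', Nat.cast_add, add_mul, Finset.sum_add_distrib,
        Nat.choose_zero_right, Nat.cast_one, one_mul, add_zero, Nat.sub_zero]
      rw [add_assoc, add_comm]
      congr 1
      refine Finset.sum_congr rfl fun j _ => ?_
      rw [show a + (j + 1) = a + 1 + j by ring, show b + (h + 1) - (j + 1) = b + h - j by omega]
    rw [hs, e1, e2]
    have h1 : (((a + b + 1) ! : ℕ) : ℝ) ≠ 0 := by positivity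
    rw [show a + (b + 1) + h + 1 = a + b + h + 2 by ring,
      show a + 1 + b + h + 1 = a + b + h + 2 by ring,
      show a + (b + 1) + 1 = a + b + 1 + 1 by ring, show a + 1 + b + 1 = a + b + 1 + 1 by ring,
      show a + b + (h + 1) + 1 = a + b + h + 2 by ring]
    simp only [Nat.factorial_succ b, Nat.factorial_succ a, Nat.factorial_succ (a + b + 1)]
    push_cast
    field_simp
    ring

lemma inner_mono (m : ℕ) (l k : Fin (m + 1)) : inner ℂ (mono m l) (mono m k) =
    if l = k then (((l : ℕ).factorial * (m - l).factorial : ℕ) : ℂ) else 0 := by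
  rw [inner_eq, innerP, Finset.sum_eq_single l]
  · rw [coeff_mono, coeff_mono, if_pos rfl]
    split_ifs <;> simp_all
  · intro b _ hb
    rw [coeff_mono, if_neg hb.symm]
    simp
  · simp

/-- On polynomials in `x₁` and `y₁` alone `Δ` acts as `y₁ ∂/∂x₁`, whence the falling factorial. -/
lemma deltaYX_pow_apply (k : ℕ) : ∀ a b : ℕ,
    (deltaYX ^ k) (X (Sum.inl 0) ^ (a + k) * X (Sum.inr 0) ^ b) =
      ((a + k).descFactorial k : ℂ) • (X (Sum.inl 0) ^ a * X (Sum.inr 0) ^ (b + k) : Poly4) := by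
  have hx : ∀ a : ℕ, deltaYX (X (Sum.inl 0) ^ (a + 1) : Poly4) =
      C ((a : ℂ) + 1) * (X (Sum.inl 0) ^ a * X (Sum.inr 0)) := by
    intro a
    induction a with
    | zero => simp [deltaYX_X_inl]
    | succ a ih =>
      rw [pow_succ, deltaYX_mul, ih, deltaYX_X_inl]
      push_cast
      simp only [C_add, C_1]
      ring
  have hy : ∀ b : ℕ, deltaYX (X (Sum.inr 0) ^ b : Poly4) = 0 := by
    intro b
    induction b with
    | zero => simp [deltaYX_apply]
    | succ b ih => rw [pow_succ, deltaYX_mul, ih, deltaYX_X_inr, zero_mul, mul_zero, add_zero]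
  induction k with
  | zero => intro a b; simp
  | succ k ih =>
    intro a b
    have h1 : deltaYX (X (Sum.inl 0) ^ (a + (k + 1)) * X (Sum.inr 0) ^ b) =
        ((a + k : ℕ) + 1 : ℂ) • (X (Sum.inl 0) ^ (a + k) * X (Sum.inr 0) ^ (b + 1) : Poly4) := by
      rw [← add_assoc, deltaYX_mul, hx, hy, mul_zero, add_zero, smul_eq_C_mul, pow_succ]
      ring
    rw [pow_succ, Module.End.mul_apply, h1, map_smul, ih, smul_smul, ← add_assoc,
      Nat.succ_descFactorial_succ, add_assoc b 1 k, add_comm 1 k]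
    push_cast
    rfl

lemma gammaXY_pow_apply (h : ℕ) (p : Poly4) : (gammaXY ^ h) p =
    (X (Sum.inl 0) * X (Sum.inr 1) - X (Sum.inr 0) * X (Sum.inl 1)) ^ h * p := by
  rw [gammaXY, LinearMap.pow_mulLeft]
  rfl

/-- The binomial expansion of `Γ ^ h`. Different `j` give different monomials, so the summands are
orthogonal. -/
lemma gammaXY_pow_monomial (a b h : ℕ) :
    (gammaXY ^ h) (X (Sum.inl 0) ^ a * X (Sum.inr 0) ^ b) =
    tensorToPoly (a + h) (b + h) (∑ j : Fin (h + 1), ((-1) ^ (h - j) * h.choose j : ℂ) •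
      mono (a + h) ⟨a + j, by omega⟩ ⊗ₜ[ℂ] mono (b + h) ⟨b + h - j, by omega⟩) := by
  rw [gammaXY_pow_apply, sub_eq_add_neg, add_pow, ← Fin.sum_univ_eq_sum_range
    (fun j => (X (Sum.inl 0) * X (Sum.inr 1)) ^ j * (-(X (Sum.inr 0) * X (Sum.inl 1))) ^ (h - j) *
      (h.choose j : Poly4)) (h + 1), Finset.sum_mul, map_sum]
  refine Finset.sum_congr rfl fun j _ => ?_
  rw [map_smul, tensorToPoly_tmul, mono_eq, mono_eq, smul_eq_C_mul]
  simp only [map_mul, map_pow, rename_X, map_neg, map_one, map_natCast]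
  rw [show a + h - (a + (j : ℕ)) = h - j by omega, show b + h - (b + h - (j : ℕ)) = j by omega,
    show b + h - (j : ℕ) = b + (h - j) by omega]
  ring

lemma alpha_mono_last (a b h : ℕ) :
    alpha (a + h) (b + h) h (a + b) (mono (a + b) (Fin.last _)) =
      ((√(cgCoeff (a + h) (b + h) h) : ℝ) * (a + b).descFactorial b : ℂ) •
      ∑ j : Fin (h + 1), ((-1) ^ (h - j) * h.choose j : ℂ) •
      mono (a + h) ⟨a + j, by omega⟩ ⊗ₜ[ℂ] mono (b + h) ⟨b + h - j, by omega⟩ := by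
  apply tensorToPoly_injective
  rw [tensorToPoly_alpha (by omega) (by omega), map_smul, mul_smul, ← gammaXY_pow_monomial,
    mono_eq, Nat.add_sub_cancel]
  have h1 := deltaYX_pow_apply b a 0
  rw [pow_zero, mul_one, zero_add] at h1
  simp only [Fin.val_last, Nat.sub_self, pow_zero, mul_one, map_pow, rename_X, h1, map_smul]

lemma inner_smul_tmul (m n : ℕ) (a b : ℂ) (u u' : P m) (v v' : P n) :
    inner ℂ (a • u ⊗ₜ[ℂ] v) (b • u' ⊗ₜ[ℂ] v') = conj a * (b * (inner ℂ u u' * inner ℂ v v')) :=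
  (inner_smul_left (u ⊗ₜ[ℂ] v) _ a).trans (congrArg _ (inner_smul_right _ (u' ⊗ₜ[ℂ] v') b))

lemma inner_smul_smul_tensor (m n : ℕ) (a b : ℂ) (u v : P m ⊗[ℂ] P n) :
    inner ℂ (a • u) (b • v) = conj a * (b * inner ℂ u v) :=
  (inner_smul_left u _ a).trans (congrArg _ (inner_smul_right _ v b))

open Nat in
-- By orthogonality only diagonal terms survive. In each of them `h! = (h.choose j) j! (h - j)!`
-- factors out, `sum_choose_mul_factorial` evaluates the rest, and the closed form of `c_{m,n,h}`
-- cancels everything except `(a + b)!`.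
lemma inner_alpha_mono_last (a b h : ℕ) :
    inner ℂ (alpha (a + h) (b + h) h (a + b) (mono (a + b) (Fin.last _)))
      (alpha (a + h) (b + h) h (a + b) (mono (a + b) (Fin.last _))) =
    inner ℂ (mono (a + b) (Fin.last _)) (mono (a + b) (Fin.last _)) := by
  have hs : ∀ x : Fin (h + 1) → ℂ, ∀ y : Fin (h + 1) → ℂ,
      inner ℂ (∑ j : Fin (h + 1), x j • mono (a + h) ⟨a + j, by omega⟩ ⊗ₜ[ℂ]
          mono (b + h) ⟨b + h - j, by omega⟩)
        (∑ j : Fin (h + 1), y j • mono (a + h) ⟨a + j, by omega⟩ ⊗ₜ[ℂ]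
          mono (b + h) ⟨b + h - j, by omega⟩) =
      ∑ j : Fin (h + 1), conj (x j) * y j *
        (((a + j)! * (h - j)! : ℕ) * ((b + h - j)! * (j : ℕ)! : ℕ)) := by
    intro x y
    rw [sum_inner]
    refine Finset.sum_congr rfl fun j _ => ?_
    rw [inner_sum, Finset.sum_eq_single j]
    · rw [inner_smul_tmul, inner_mono, inner_mono, if_pos rfl, if_pos rfl]
      simp only
      rw [show a + h - (a + (j : ℕ)) = h - j by omega,
        show b + h - (b + h - (j : ℕ)) = j by omega]
      ring
    · intro k _ hk
      have : (j : ℕ) ≠ k := fun e => hk (Fin.ext e.symm)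
      rw [inner_smul_tmul, inner_mono, if_neg]
      · simp
      · simpa using this
    · simp
  have hc := cgCoeff_eq (b + h) a b h rfl
  have hc0 : 0 ≤ cgCoeff (a + h) (b + h) h := by rw [hc]; positivity
  have hsum := sum_choose_mul_factorial h a b
  have hd : ((a + b).descFactorial b : ℝ) = (a + b)! / a ! := by
    rw [eq_div_iff (by positivity), ← Nat.cast_mul, mul_comm]
    have := Nat.factorial_mul_descFactorial (show b ≤ a + b by omega)
    rw [Nat.add_sub_cancel] at this
    rw [this]
  have hterm : ∀ j : Fin (h + 1), conj ((-1) ^ (h - j) * h.choose j : ℂ) *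
      ((-1) ^ (h - j) * h.choose j : ℂ) *
        (((a + j)! * (h - j)! : ℕ) * ((b + h - j)! * (j : ℕ)! : ℕ)) =
      ((h ! * ((h.choose j : ℝ) * ((a + j)! * (b + h - j)! : ℕ)) : ℝ) : ℂ) := by
    intro j
    have h1 : (-1 : ℂ) ^ (h - (j : ℕ)) * (-1) ^ (h - (j : ℕ)) = 1 := by
      rw [← mul_pow]; simp
    have h2 := Nat.choose_mul_factorial_mul_factorial (Nat.lt_succ_iff.1 j.2)
    rw [← h2]
    simp only [map_mul, map_pow, map_neg, map_one, Complex.conj_natCast]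
    push_cast
    linear_combination ((h.choose j : ℂ) ^ 2 * (((a + j)! : ℂ) * (h - j)! *
      ((b + h - j)! * (j : ℕ)!))) * h1
  rw [alpha_mono_last, inner_smul_smul_tensor, hs]
  simp only [hterm]
  rw [← Complex.ofReal_sum, ← Finset.mul_sum, Fin.sum_univ_eq_sum_range
    (fun j => (h.choose j : ℝ) * ((a + j)! * (b + h - j)! : ℕ)) (h + 1), hsum, inner_mono,
    if_pos rfl]
  simp only [map_mul, Complex.conj_ofReal, Complex.conj_natCast, Fin.val_last, Nat.sub_self,
    Nat.factorial_zero, mul_one]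
  rw [← Complex.ofReal_natCast ((a + b).descFactorial b), ← Complex.ofReal_natCast ((a + b)!)]
  norm_cast
  have hsq := Real.mul_self_sqrt hc0
  have h1 : ((a ! : ℕ) : ℝ) ≠ 0 := by positivity
  have h2 : ((b ! : ℕ) : ℝ) ≠ 0 := by positivity
  have h3 : ((h ! : ℕ) : ℝ) ≠ 0 := by positivity
  have h4 : (((a + b) ! : ℕ) : ℝ) ≠ 0 := by positivity
  have h5 : (((a + b + h + 1) ! : ℕ) : ℝ) ≠ 0 := by positivity
  rw [hd]
  calc _ = (√(cgCoeff (a + h) (b + h) h) * √(cgCoeff (a + h) (b + h) h)) *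
        (((a + b)! / a !) ^ 2 * (h ! * (a ! * b ! * (a + b + h + 1)! / (a + b + 1)!))) := by
        push_cast; ring
    _ = _ := by
      rw [hsq, hc, Nat.factorial_succ (a + b)]
      push_cast
      field_simp

/-- The map `α_{m,n,h}` is an isometry. -/
lemma inner_alpha {m n h r : ℕ} (hh : h ≤ min m n) (hr : r + 2 * h = m + n) (f f' : P r) :
    inner ℂ (alpha m n h r f) (alpha m n h r f') = inner ℂ f f' := by
  rw [le_min_iff] at hh
  obtain ⟨a, rfl⟩ : ∃ a, m = a + h := ⟨m - h, by omega⟩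
  obtain ⟨b, rfl⟩ : ∃ b, n = b + h := ⟨n - h, by omega⟩
  obtain rfl : r = a + b := by omega
  exact inner_map_map_of_intertwining ((isUnitaryRep_rho _).tprod (isUnitaryRep_rho _))
    (fun g f => alpha_rho (le_min_iff.2 hh) hr g f) (mono_ne_zero _ (Fin.last _))
    (inner_alpha_mono_last a b h) f f'

/-! ### The maps `η` -/

lemma isUnitaryRep_tensorRep (m r : ℕ) : IsUnitaryRep (tensorRep m r) :=
  (isUnitaryRep_rho m).tprod (isUnitaryRep_rho r).conj

lemma eta_rho {m r l s : ℕ} (hl : l ≤ min m r) (hs : s + 2 * l = m + r) (g : SU2) (f : P s) :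
    eta m r l s (rho s g f) = tensorRep m r g (eta m r l s f) := by
  rw [eta, LinearMap.comp_apply, LinearMap.comp_apply, alpha_rho hl hs]
  suffices h : TensorProduct.map LinearMap.id (J r) ∘ₗ TensorProduct.map (rho m g) (rho r g) =
      tensorRep m r g ∘ₗ TensorProduct.map LinearMap.id (J r) from
    DFunLike.congr_fun h _
  rw [tensorRep, Representation.tprod_apply, ← TensorProduct.map_comp, ← TensorProduct.map_comp]
  congr 1
  exact LinearMap.ext fun v => J_rho r g v

lemma inner_eta {m r l s : ℕ} (hl : l ≤ min m r) (hs : s + 2 * l = m + r) (f f' : P s) :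
    inner ℂ (eta m r l s f) (eta m r l s f') = inner ℂ f f' := by
  rw [← inner_alpha hl hs]
  exact TensorProduct.inner_map_map LinearIsometry.id (unitaryJ r).toLinearIsometry _ _

lemma adjoint_eta_rho {m r l s : ℕ} (hl : l ≤ min m r) (hs : s + 2 * l = m + r) (g : SU2)
    (z : P m ⊗[ℂ] Conj (P r)) :
    LinearMap.adjoint (eta m r l s) (tensorRep m r g z) =
      rho s g (LinearMap.adjoint (eta m r l s) z) :=
  (isUnitaryRep_rho s).adjoint_apply (isUnitaryRep_tensorRep m r) (eta_rho hl hs) g z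

lemma adjoint_eta_eta {m r l s : ℕ} (hl : l ≤ min m r) (hs : s + 2 * l = m + r) (f : P s) :
    LinearMap.adjoint (eta m r l s) (eta m r l s f) = f := by
  refine ext_inner_right ℂ fun v => ?_
  rw [LinearMap.adjoint_inner_left, inner_eta hl hs]

/-- Intertwining maps out of an irreducible representation to `P s` vanish unless the dimensions
agree. -/
lemma eq_zero_of_finrank_ne {V : Type*} [AddCommGroup V] [Module ℂ V] {σ : Representation ℂ SU2 V}
    [σ.IsIrreducible] {s : ℕ} (T : V →ₗ[ℂ] P s) (hT : ∀ g v, T (σ g v) = rho s g (T v))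
    (hd : Module.finrank ℂ V ≠ s + 1) : T = 0 := by
  let F : σ.IntertwiningMap (rho s) := ⟨T, fun g => LinearMap.ext fun v => hT g v⟩
  rcases Representation.IsIrreducible.bijective_or_eq_zero F with h | h
  · refine absurd ?_ hd
    rw [← finrank_P s]
    exact (LinearEquiv.ofBijective T h).finrank_eq
  · exact congrArg Representation.IntertwiningMap.toLinearMap h

lemma eq_zero_of_mem_of_finrank_ne {V : Type*} [AddCommGroup V] [Module ℂ V]
    {σ : Representation ℂ SU2 V} (W : Subrepresentation σ)
    (hW : Representation.IsIrreducible (V := W.toSubmodule) W.toRepresentation) {s : ℕ}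
    (T : V →ₗ[ℂ] P s) (hT : ∀ g v, T (σ g v) = rho s g (T v))
    (hd : Module.finrank ℂ W.toSubmodule ≠ s + 1) {z : V} (hz : z ∈ W.toSubmodule) : T z = 0 :=
  DFunLike.congr_fun (eq_zero_of_finrank_ne (σ := W.toRepresentation)
    (T ∘ₗ W.toSubmodule.subtype) (fun g v => hT g v.1) hd) ⟨z, hz⟩

/-- The composite intertwines irreducibles of different dimensions. In other words, the ranges of
the two maps `η` are orthogonal. -/
lemma adjoint_eta_eta_of_ne {m r l s l' s' : ℕ} (hl : l ≤ min m r) (hs : s + 2 * l = m + r)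
    (hl' : l' ≤ min m r) (hs' : s' + 2 * l' = m + r) (hne : s ≠ s') (f : P s') :
    LinearMap.adjoint (eta m r l s) (eta m r l' s' f) = 0 := by
  have h := eq_zero_of_finrank_ne (σ := rho s') (LinearMap.adjoint (eta m r l s) ∘ₗ eta m r l' s')
    (fun g v => by
      rw [LinearMap.comp_apply, eta_rho hl' hs', adjoint_eta_rho hl hs, LinearMap.comp_apply])
    (by rw [finrank_P]; omega)
  exact DFunLike.congr_fun h f

lemma finrank_conj_P (m : ℕ) : Module.finrank ℂ (Conj (P m)) = m + 1 := by
  rw [← (unitaryJ m).toLinearEquiv.finrank_eq, finrank_P]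

/-- The dimension count of the Clebsch-Gordan decomposition, obtained from a closed form for the
partial sums up to `k ≤ min m r`, where the subtractions are not truncated. -/
lemma sum_dim (m r : ℕ) : ∑ l : Fin (min m r + 1), (m + r - 2 * l + 1) = (m + 1) * (r + 1) := by
  have key : ∀ k, k ≤ min m r →
      ∑ l ∈ Finset.range (k + 1), (m + r - 2 * l + 1) = (k + 1) * (m + r + 1 - k) := by
    intro k
    induction k with
    | zero => simp
    | succ k ih =>
      intro hk
      rw [Finset.sum_range_succ, ih (by omega)]
      obtain ⟨d, hd⟩ : ∃ d, m + r = 2 * (k + 1) + d := ⟨m + r - 2 * (k + 1), by omega⟩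
      rw [hd, show 2 * (k + 1) + d + 1 - k = k + d + 3 by omega,
        show 2 * (k + 1) + d - 2 * (k + 1) + 1 = d + 1 by omega,
        show 2 * (k + 1) + d + 1 - (k + 1) = k + d + 2 by omega]
      ring
  rw [Fin.sum_univ_eq_sum_range (fun l => m + r - 2 * l + 1), key _ le_rfl]
  rcases le_total m r with h | h
  · rw [min_eq_left h, show m + r + 1 - m = r + 1 by omega]
  · rw [min_eq_right h, show m + r + 1 - r = m + 1 by omega, mul_comm]

/-- The ranges of the maps `η_{m,r,l}` together span `P m ⊗ Conj (P r)`. -/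
lemma eq_zero_of_adjoint_eta_eq_zero {m r : ℕ} {z : P m ⊗[ℂ] Conj (P r)}
    (hz : ∀ l s, l ≤ min m r → s + 2 * l = m + r → LinearMap.adjoint (eta m r l s) z = 0) :
    z = 0 := by
  -- The sum of all `η_{m,r,l}`. The adjoints recover each component, so it is injective, and
  -- equality of dimensions makes it surjective.
  let E : (∀ l : Fin (min m r + 1), P (m + r - 2 * l)) →ₗ[ℂ] P m ⊗[ℂ] Conj (P r) :=
    ∑ l : Fin (min m r + 1), eta m r (l : ℕ) (m + r - 2 * (l : ℕ)) ∘ₗ LinearMap.proj l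
  have hE : ∀ v (l : Fin (min m r + 1)), LinearMap.adjoint (eta m r l (m + r - 2 * l)) (E v) = v l := by
    intro v l
    simp only [E, LinearMap.sum_apply, LinearMap.comp_apply, LinearMap.proj_apply, map_sum]
    rw [Finset.sum_eq_single l]
    · exact adjoint_eta_eta (by omega) (by omega) _
    · intro k _ hk
      have : (k : ℕ) ≠ l := fun e => hk (Fin.ext e)
      exact adjoint_eta_eta_of_ne (by omega) (by omega) (by omega) (by omega) (by omega) _
    · simp
  have hinj : Function.Injective E := fun v w h => by
    ext1 l
    rw [← hE v l, h, hE]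
  have hdim : Module.finrank ℂ (∀ l : Fin (min m r + 1), P (m + r - 2 * l)) =
      Module.finrank ℂ (P m ⊗[ℂ] Conj (P r)) := by
    rw [Module.finrank_pi_fintype]
    simp only [finrank_P]
    rw [Module.finrank_tensorProduct, finrank_P, finrank_conj_P, sum_dim]
  obtain ⟨v, rfl⟩ := (LinearMap.injective_iff_surjective_of_finrank_eq_finrank hdim).1 hinj z
  have : v = 0 := by
    ext1 l
    rw [← hE v l, hz _ _ (by omega) (by omega)]
    rfl
  rw [this, map_zero]

lemma projQ_apply (m r l s : ℕ) (z : P m ⊗[ℂ] Conj (P r)) :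
    projQ m r l s z = eta m r l s (LinearMap.adjoint (eta m r l s) z) := rfl

/-- A vector annihilated by all `η_{m,r,l'}^*` with `l' ≠ l` lies in the range of `η_{m,r,l}`. -/
lemma projQ_eq_self {m r l s : ℕ} (hl : l ≤ min m r) (hs : s + 2 * l = m + r)
    {z : P m ⊗[ℂ] Conj (P r)}
    (hz : ∀ l' s', l' ≤ min m r → s' + 2 * l' = m + r → s' ≠ s →
      LinearMap.adjoint (eta m r l' s') z = 0) : projQ m r l s z = z := by
  -- It suffices that `z - q z` is annihilated by every `η^*`, including the one with index `l`.
  rw [eq_comm, ← sub_eq_zero]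
  refine eq_zero_of_adjoint_eta_eq_zero fun l' s' hl' hs' => ?_
  rw [map_sub, projQ_apply]
  by_cases h : s' = s
  · obtain rfl : l' = l := by omega
    subst h
    rw [adjoint_eta_eta hl hs, sub_self]
  · rw [adjoint_eta_eta_of_ne hl' hs' hl hs h, hz l' s' hl' hs' h, sub_zero]

/-- The range of `η_{m,r,l}` as a subrepresentation. -/
def rangeEta {m r l s : ℕ} (hl : l ≤ min m r) (hs : s + 2 * l = m + r) :
    Subrepresentation (tensorRep m r) where
  toSubmodule := LinearMap.range (eta m r l s)
  apply_mem_toSubmodule g v hv := by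
    obtain ⟨f, rfl⟩ := hv
    exact ⟨rho s g f, eta_rho hl hs g f⟩

lemma eta_injective {m r l s : ℕ} (hl : l ≤ min m r) (hs : s + 2 * l = m + r) :
    Function.Injective (eta m r l s) :=
  Function.LeftInverse.injective (adjoint_eta_eta hl hs)

lemma finrank_rangeEta {m r l s : ℕ} (hl : l ≤ min m r) (hs : s + 2 * l = m + r) :
    Module.finrank ℂ (rangeEta hl hs).toSubmodule = s + 1 := by
  rw [← finrank_P s]
  exact LinearMap.finrank_range_of_inj (eta_injective hl hs)

lemma isIrreducible_of_forall_invariant {G V : Type*} [Group G] [AddCommGroup V] [Module ℂ V]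
    {ρ : Representation ℂ G V} {W : Subrepresentation ρ} (hW : W.toSubmodule ≠ ⊥)
    (h : ∀ U : Submodule ℂ V, U ≤ W.toSubmodule → (∀ g, ∀ v ∈ U, ρ g v ∈ U) →
      U = ⊥ ∨ U = W.toSubmodule) :
    Representation.IsIrreducible (V := W.toSubmodule) W.toRepresentation where
  exists_pair_ne := ⟨⊥, ⊤, fun e => hW (by
    have e' : (⊥ : Submodule ℂ W.toSubmodule) = ⊤ := congrArg Subrepresentation.toSubmodule e
    have := congrArg (Submodule.map W.toSubmodule.subtype) e'
    simpa using this.symm)⟩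
  eq_bot_or_eq_top U := by
    rcases h (U.toSubmodule.map W.toSubmodule.subtype) (Submodule.map_subtype_le _ _) (by
      rintro g _ ⟨u, hu, rfl⟩
      exact ⟨_, U.apply_mem_toSubmodule g hu, rfl⟩) with h | h
    · left
      apply Subrepresentation.toSubmodule_injective
      apply Submodule.map_injective_of_injective (Submodule.subtype_injective W.toSubmodule)
      rw [h]
      exact (Submodule.map_bot _).symm
    · right
      apply Subrepresentation.toSubmodule_injective
      apply Submodule.map_injective_of_injective (Submodule.subtype_injective W.toSubmodule)
      rw [h]
      change _ = Submodule.map W.toSubmodule.subtype ⊤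
      simp

/-- The preimage under `η` of an invariant subspace of the range is invariant in `P s`, hence
trivial or everything. -/
lemma isIrreducible_rangeEta {m r l s : ℕ} (hl : l ≤ min m r) (hs : s + 2 * l = m + r) :
    Representation.IsIrreducible (V := (rangeEta hl hs).toSubmodule)
      (rangeEta hl hs).toRepresentation := by
  refine isIrreducible_of_forall_invariant (fun h => ?_) fun U hU hinv => ?_
  · have := finrank_rangeEta hl hs
    rw [h, finrank_bot] at this
    omega
  · have hU' : (U.comap (eta m r l s)).map (eta m r l s) = U :=
      Submodule.map_comap_eq_of_le hU
    by_cases h0 : U.comap (eta m r l s) = ⊥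
    · left
      rw [← hU', h0, Submodule.map_bot]
    · right
      rw [← hU', eq_top_of_invariant _ (fun g f hf => ?_) h0, Submodule.map_top]
      · rfl
      · rw [Submodule.mem_comap] at hf ⊢
        rw [eta_rho hl hs]
        exact hinv g _ hf

/-- The range of `η_{m,r,l}` is the only irreducible subspace of its dimension. -/
lemma eq_rangeEta {m r l s : ℕ} (hl : l ≤ min m r) (hs : s + 2 * l = m + r)
    (W : Subrepresentation (tensorRep m r))
    (hW : Representation.IsIrreducible (V := W.toSubmodule) W.toRepresentation)
    (hd : Module.finrank ℂ W.toSubmodule = s + 1) : W = rangeEta hl hs := by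
  apply Subrepresentation.toSubmodule_injective
  refine Submodule.eq_of_le_of_finrank_eq (fun z hz => ?_) (by rw [hd, finrank_rangeEta])
  have h : projQ m r l s z = z := projQ_eq_self hl hs fun l' s' hl' hs' hne =>
    eq_zero_of_mem_of_finrank_ne W hW _ (adjoint_eta_rho hl' hs') (by rw [hd]; omega) hz
  rw [← h]
  exact ⟨_, rfl⟩

lemma projQ_eq_starProjection {m r l s : ℕ} (hl : l ≤ min m r) (hs : s + 2 * l = m + r) :
    projQ m r l s = (rangeEta hl hs).toSubmodule.starProjection.toLinearMap := by
  refine LinearMap.ext fun z => Eq.symm ?_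
  refine Submodule.eq_starProjection_of_mem_orthogonal ⟨_, rfl⟩ ?_
  rw [Submodule.mem_orthogonal]
  rintro _ ⟨f, rfl⟩
  rw [inner_sub_right, projQ_apply, inner_eta hl hs, LinearMap.adjoint_inner_right, sub_self]

/-! ### The Choi matrix of a channel in Stinespring form -/

section Choi

variable {H K L ι κ μ : Type*} [NormedAddCommGroup H] [InnerProductSpace ℂ H]
  [NormedAddCommGroup K] [InnerProductSpace ℂ K] [NormedAddCommGroup L] [InnerProductSpace ℂ L]
  [Fintype ι] [Fintype κ] [Fintype μ]

lemma tensor_inner_smul_left (c : ℂ) (x y : K ⊗[ℂ] L) :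
    inner ℂ (c • x) y = conj c * inner ℂ x y := inner_smul_left x y c

lemma tensor_inner_smul_right (c : ℂ) (x y : K ⊗[ℂ] L) :
    inner ℂ x (c • y) = c * inner ℂ x y := inner_smul_right x y c

/-- The map `Conj L → K ⊗ Conj H` obtained by bending `T : H → K ⊗ L`. -/
def reshuffle (bH : OrthonormalBasis ι ℂ H) (bK : OrthonormalBasis κ ℂ K) (T : H →ₗ[ℂ] K ⊗[ℂ] L) :
    Conj L →ₗ[ℂ] K ⊗[ℂ] Conj H where
  toFun w := ∑ p, ∑ i, inner ℂ (bK p ⊗ₜ[ℂ] toConj.symm w) (T (bH i)) • (bK p ⊗ₜ toConj (bH i))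
  map_add' w w' := by
    simp only [map_add, TensorProduct.tmul_add, inner_add_left, add_smul, Finset.sum_add_distrib]
  map_smul' c w := by
    have h : toConj.symm (c • w) = conj c • toConj.symm w := rfl
    simp only [h, TensorProduct.tmul_smul, tensor_inner_smul_left, Complex.conj_conj, mul_smul,
      Finset.smul_sum, RingHom.id_apply]

/-- Both sides are conjugate-linear in `a` and linear in `f`, so expansion in the two bases
suffices. The formula characterises the bent map without bases, and later arguments use it in place
of the definition. -/
lemma inner_reshuffle (bH : OrthonormalBasis ι ℂ H) (bK : OrthonormalBasis κ ℂ K)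
    (T : H →ₗ[ℂ] K ⊗[ℂ] L) (a : K) (f : H) (v : L) :
    inner ℂ (a ⊗ₜ[ℂ] toConj f) (reshuffle bH bK T (toConj v)) = inner ℂ (a ⊗ₜ[ℂ] v) (T f) := by
  conv_rhs => rw [← bH.sum_repr' f, ← bK.sum_repr' a]
  change inner ℂ _ (∑ p, ∑ i, inner ℂ (bK p ⊗ₜ[ℂ] v) (T (bH i)) • (bK p ⊗ₜ toConj (bH i))) = _
  simp only [TensorProduct.sum_tmul, map_sum, map_smul, inner_sum, sum_inner,
    ← TensorProduct.smul_tmul', tensor_inner_smul_left, tensor_inner_smul_right,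
    TensorProduct.inner_tmul, inner_toConj, inner_conj_symm]
  rw [Finset.sum_comm]
  refine Finset.sum_congr rfl fun i _ => ?_
  exact Finset.sum_congr rfl fun p _ => by ring

lemma toConj_sum_smul (b : μ → L) (c : μ → ℂ) :
    toConj (∑ k, c k • b k) = ∑ k, conj (c k) • toConj (b k) := by
  rw [map_sum]
  simp only [smul_toConj, Complex.conj_conj]

/-- An orthonormal basis, as a basis of the conjugate space. -/
def conjBasis (b : OrthonormalBasis μ ℂ L) : OrthonormalBasis μ ℂ (Conj L) :=
  OrthonormalBasis.mk (v := fun k => toConj (b k))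
    (by
      classical
      rw [orthonormal_iff_ite]
      intro i j
      rw [inner_toConj, b.inner_eq_ite]
      simp only [eq_comm])
    (by
      intro w _
      have h : w = toConj (∑ k, inner ℂ (b k) (toConj.symm w) • b k) := by
        rw [b.sum_repr', AddEquiv.apply_symm_apply]
      rw [h, toConj_sum_smul]
      exact Submodule.sum_mem _ fun k _ => Submodule.smul_mem _ _ (Submodule.subset_span ⟨k, rfl⟩))

lemma conjBasis_apply (b : OrthonormalBasis μ ℂ L) (k : μ) : conjBasis b k = toConj (b k) := by
  simp [conjBasis]

/-- Bending rearranges matrix entries, so it preserves the Hilbert-Schmidt norm: by Parseval both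
sides are the sum of all `|⟨bK p ⊗ bL k, T (bH i)⟩|²`. -/
lemma sum_inner_reshuffle (bH : OrthonormalBasis ι ℂ H) (bK : OrthonormalBasis κ ℂ K)
    (bL : OrthonormalBasis μ ℂ L) (T : H →ₗ[ℂ] K ⊗[ℂ] L) :
    ∑ k, inner ℂ (reshuffle bH bK T (conjBasis bL k)) (reshuffle bH bK T (conjBasis bL k)) =
      ∑ i, inner ℂ (T (bH i)) (T (bH i)) := by
  have h1 : ∀ k, inner ℂ (reshuffle bH bK T (conjBasis bL k)) (reshuffle bH bK T (conjBasis bL k)) =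
      ∑ p, ∑ i, conj (inner ℂ (bK p ⊗ₜ[ℂ] bL k) (T (bH i))) *
        inner ℂ (bK p ⊗ₜ[ℂ] bL k) (T (bH i)) := by
    intro k
    rw [← (bK.tensorProduct (conjBasis bH)).sum_inner_mul_inner, Fintype.sum_prod_type]
    refine Finset.sum_congr rfl fun p _ => Finset.sum_congr rfl fun i _ => ?_
    rw [← inner_conj_symm, OrthonormalBasis.tensorProduct_apply, conjBasis_apply, conjBasis_apply,
      inner_reshuffle]
  have h2 : ∀ i, inner ℂ (T (bH i)) (T (bH i)) =
      ∑ p, ∑ k, conj (inner ℂ (bK p ⊗ₜ[ℂ] bL k) (T (bH i))) *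
        inner ℂ (bK p ⊗ₜ[ℂ] bL k) (T (bH i)) := by
    intro i
    rw [← (bK.tensorProduct bL).sum_inner_mul_inner, Fintype.sum_prod_type]
    refine Finset.sum_congr rfl fun p _ => Finset.sum_congr rfl fun k _ => ?_
    rw [← inner_conj_symm, OrthonormalBasis.tensorProduct_apply]
  simp only [h1, h2]
  rw [Finset.sum_comm]
  conv_rhs => rw [Finset.sum_comm]
  exact Finset.sum_congr rfl fun p _ => Finset.sum_comm

lemma inner_partialTrace [FiniteDimensional ℂ K] [FiniteDimensional ℂ L]
    (bL : OrthonormalBasis μ ℂ L) (M : K ⊗[ℂ] L →ₗ[ℂ] K ⊗[ℂ] L) (a a' : K) :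
    inner ℂ a (partialTrace K L M a') = ∑ k, inner ℂ (a ⊗ₜ[ℂ] bL k) (M (a' ⊗ₜ[ℂ] bL k)) := by
  obtain ⟨z, rfl⟩ := (homTensorHomEquiv ℂ K L K L).surjective M
  induction z with
  | zero => simp
  | add x y hx hy =>
    simp only [map_add, LinearMap.add_apply, inner_add_right, hx, hy, Finset.sum_add_distrib]
  | tmul A B =>
    have h : homTensorHomEquiv ℂ K L K L (A ⊗ₜ B) = TensorProduct.map A B := by
      rw [homTensorHomEquiv_apply]
      rfl
    rw [h, partialTrace_map, LinearMap.smul_apply, inner_smul_right,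
      LinearMap.trace_eq_sum_inner _ bL, Finset.sum_mul]
    refine Finset.sum_congr rfl fun k _ => ?_
    rw [TensorProduct.map_tmul, TensorProduct.inner_tmul, mul_comm]

/-- Expanding `f f'^*` in the matrix units `E_ij` gives the coefficients `⟨b_i, f⟩⟨f', b_j⟩`, which
are exactly the matrix coefficients of `E_ij` on the conjugate space. -/
lemma inner_choi (b : OrthonormalBasis ι ℂ H) (Φ : (H →ₗ[ℂ] H) →ₗ[ℂ] (K →ₗ[ℂ] K)) (a a' : K)
    (f f' : H) :
    inner ℂ (a ⊗ₜ[ℂ] toConj f) (choi b Φ (a' ⊗ₜ[ℂ] toConj f')) =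
      inner ℂ a (Φ (ketbra f f') a') := by
  have hk : ketbra f f' = ∑ i, ∑ j, (inner ℂ (b i) f * inner ℂ f' (b j)) • ketbra (b i) (b j) := by
    refine LinearMap.ext fun z => ?_
    simp only [LinearMap.sum_apply, LinearMap.smul_apply, ketbra_apply, smul_smul]
    rw [← b.sum_inner_mul_inner]
    conv_lhs => rw [← b.sum_repr' f, Finset.smul_sum]
    refine Finset.sum_congr rfl fun i _ => ?_
    rw [smul_smul, Finset.sum_mul, Finset.sum_smul]
    refine Finset.sum_congr rfl fun j _ => ?_
    congr 1
    ring
  rw [hk]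
  simp only [choi, map_sum, map_smul, LinearMap.sum_apply, LinearMap.smul_apply, inner_sum,
    inner_smul_right, TensorProduct.map_tmul, TensorProduct.inner_tmul]
  refine Finset.sum_congr rfl fun i _ => Finset.sum_congr rfl fun j _ => ?_
  have : conjMap (ketbra (b i) (b j)) (toConj f') = toConj (ketbra (b i) (b j) f') := rfl
  rw [this, inner_toConj, ketbra_apply, inner_smul_left, inner_conj_symm]
  ring

/-- Matrix coefficients of both sides equal `∑ k, ⟨a ⊗ b_k, T f⟩ ⟨T f', a' ⊗ b_k⟩`. The sum over `k`
is the partial trace on the left and Parseval's identity in `Conj L` on the right. -/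
lemma choi_eq_reshuffle [FiniteDimensional ℂ H] [FiniteDimensional ℂ K] [FiniteDimensional ℂ L]
    (bH : OrthonormalBasis ι ℂ H) (bK : OrthonormalBasis κ ℂ K) (bL : OrthonormalBasis μ ℂ L)
    (T : H →ₗ[ℂ] K ⊗[ℂ] L) (Φ : (H →ₗ[ℂ] H) →ₗ[ℂ] (K →ₗ[ℂ] K))
    (hΦ : ∀ A, Φ A = partialTrace K L (T ∘ₗ A ∘ₗ LinearMap.adjoint T)) :
    choi bH Φ = reshuffle bH bK T ∘ₗ LinearMap.adjoint (reshuffle bH bK T) := by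
  refine TensorProduct.ext' fun a' w' => (TensorProduct.ext_iff_inner_left (𝕜 := ℂ)).2 fun a w => ?_
  obtain ⟨f, rfl⟩ := toConj.surjective w
  obtain ⟨f', rfl⟩ := toConj.surjective w'
  rw [inner_choi, hΦ, inner_partialTrace bL, LinearMap.comp_apply, ← LinearMap.adjoint_inner_left,
    ← (conjBasis bL).sum_inner_mul_inner]
  refine Finset.sum_congr rfl fun k _ => ?_
  rw [LinearMap.adjoint_inner_left, LinearMap.adjoint_inner_right, conjBasis_apply,
    inner_reshuffle, ← inner_conj_symm, inner_reshuffle, LinearMap.comp_apply,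
    LinearMap.comp_apply, ketbra_apply, map_smul, tensor_inner_smul_right,
    LinearMap.adjoint_inner_right, ← inner_conj_symm (T f'), mul_comm]

/-- By `inner_reshuffle` the claim becomes a statement about matrix coefficients of `T`, where
unitarity lets `g` pass from one side of the inner product to the other. -/
lemma reshuffle_intertwining {G : Type*} [Group G] {π : Representation ℂ G H}
    {σ : Representation ℂ G K} {τ : Representation ℂ G L} (hπ : IsUnitaryRep π)
    (hσ : IsUnitaryRep σ) (hτ : IsUnitaryRep τ)
    (bH : OrthonormalBasis ι ℂ H) (bK : OrthonormalBasis κ ℂ K) {T : H →ₗ[ℂ] K ⊗[ℂ] L}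
    (hT : ∀ g f, T (π g f) = σ.tprod τ g (T f)) (g : G) (w : Conj L) :
    reshuffle bH bK T (conjRep τ g w) = σ.tprod (conjRep π) g (reshuffle bH bK T w) := by
  refine (TensorProduct.ext_iff_inner_left (𝕜 := ℂ)).2 fun a u => ?_
  obtain ⟨f, rfl⟩ := toConj.surjective u
  obtain ⟨v, rfl⟩ := toConj.surjective w
  have h1 : conjRep τ g (toConj v) = toConj (τ g v) := rfl
  have h2 : conjRep π g⁻¹ (toConj f) = toConj (π g⁻¹ f) := rfl
  have h3 := (hσ.tprod hπ.conj) g⁻¹ (a ⊗ₜ[ℂ] toConj f) (reshuffle bH bK T (toConj v))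
  rw [inv_inv] at h3
  rw [h1, inner_reshuffle, ← h3, Representation.tprod_apply, TensorProduct.map_tmul, h2,
    inner_reshuffle, hT, ← hσ.tprod hτ, Representation.tprod_apply, TensorProduct.map_tmul,
    Representation.self_inv_apply]

end Choi

/-! ### The Choi matrix of an EPOSIC channel -/

lemma J_adjoint_J (m : ℕ) (w : Conj (P m)) : J m (LinearMap.adjoint (J m) w) = w := by
  obtain ⟨f, rfl⟩ := J_surjective m w
  congr 1
  refine ext_inner_right ℂ fun v => ?_
  rw [LinearMap.adjoint_inner_left, inner_J]

/-- Every intertwining map `P s → P m ⊗ Conj (P r)` is a multiple of `η_{m,r,l}`. -/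
lemma exists_eq_smul_eta {m r l s : ℕ} (hl : l ≤ min m r) (hs : s + 2 * l = m + r)
    {S : P s →ₗ[ℂ] P m ⊗[ℂ] Conj (P r)} (hS : ∀ g f, S (rho s g f) = tensorRep m r g (S f)) :
    ∃ c : ℂ, S = c • eta m r l s := by
  obtain ⟨c, hc⟩ := exists_eq_smul_of_commute (LinearMap.adjoint (eta m r l s) ∘ₗ S) fun g f => by
    rw [LinearMap.comp_apply, hS, adjoint_eta_rho hl hs, LinearMap.comp_apply]
  refine ⟨c, LinearMap.ext fun f => ?_⟩
  -- By Schur's lemma the components of `S f` in the other ranges vanish, so `S f` lies in the range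
  -- of `η_{m,r,l}`.
  have h : projQ m r l s (S f) = S f := projQ_eq_self hl hs fun l' s' hl' hs' hne =>
    DFunLike.congr_fun (eq_zero_of_finrank_ne (σ := rho s)
      (LinearMap.adjoint (eta m r l' s') ∘ₗ S)
      (fun g v => by rw [LinearMap.comp_apply, hS, adjoint_eta_rho hl' hs', LinearMap.comp_apply])
      (by rw [finrank_P]; omega)) f
  rw [← h, projQ_apply, LinearMap.smul_apply, ← map_smul]
  exact congrArg _ (hc f)

/-- The map `Conj (P n) → P m ⊗ Conj (P r)` obtained by bending `α_{m,n,h}`. -/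
def bentAlpha (m n h r : ℕ) : Conj (P n) →ₗ[ℂ] P m ⊗[ℂ] Conj (P r) :=
  reshuffle (canonicalBasis r) (canonicalBasis m) (alpha m n h r)

lemma bentAlpha_rho {m n h r : ℕ} (hh : h ≤ min m n) (hr : r + 2 * h = m + n) (g : SU2)
    (w : Conj (P n)) :
    bentAlpha m n h r (conjRep (rho n) g w) = tensorRep m r g (bentAlpha m n h r w) :=
  reshuffle_intertwining (isUnitaryRep_rho r) (isUnitaryRep_rho m) (isUnitaryRep_rho n)
    (canonicalBasis r) (canonicalBasis m) (T := alpha m n h r) (alpha_rho hh hr) g w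

lemma choi_eposic_eq_bentAlpha (m n h r : ℕ) : choi (canonicalBasis r) (eposic m n h r) =
    bentAlpha m n h r ∘ₗ LinearMap.adjoint (bentAlpha m n h r) :=
  choi_eq_reshuffle _ (canonicalBasis m) (canonicalBasis n) (alpha m n h r) _ fun _ => rfl

lemma sum_inner_bentAlpha {m n h r : ℕ} (hh : h ≤ min m n) (hr : r + 2 * h = m + n) :
    ∑ k, inner ℂ (bentAlpha m n h r (conjBasis (canonicalBasis n) k))
      (bentAlpha m n h r (conjBasis (canonicalBasis n) k)) = (r : ℂ) + 1 := by
  have h2 : ∀ i, inner ℂ (alpha m n h r (canonicalBasis r i)) (alpha m n h r (canonicalBasis r i))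
      = 1 := fun i => by
    rw [inner_alpha hh hr, OrthonormalBasis.inner_eq_ite, if_pos rfl]
  refine (sum_inner_reshuffle (canonicalBasis r) (canonicalBasis m) (canonicalBasis n)
    (alpha m n h r)).trans ?_
  rw [Finset.sum_congr rfl fun i _ => h2 i]
  simp

/-- Precomposition with `J n` makes the source `P n` instead of its conjugate. The index is `m - h`
because `n = m + r - 2 (m - h)`. -/
lemma exists_bentAlpha_J_eq {m n h r : ℕ} (hh : h ≤ min m n) (hr : r + 2 * h = m + n) :
    ∃ c : ℂ, ∀ f, bentAlpha m n h r (J n f) = c • eta m r (m - h) n f := by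
  have hh' := le_min_iff.1 hh
  have h1 : ∀ g f, (bentAlpha m n h r ∘ₗ J n) (rho n g f) =
      tensorRep m r g ((bentAlpha m n h r ∘ₗ J n) f) := fun g f => by
    have h2 := bentAlpha_rho hh hr g (J n f)
    rw [← J_rho] at h2
    exact h2
  have hl : m - h ≤ min m r := by omega
  have hs : n + 2 * (m - h) = m + r := by omega
  obtain ⟨c, hc⟩ := exists_eq_smul_eta hl hs h1
  exact ⟨c, fun f => DFunLike.congr_fun hc f⟩

lemma choi_eposic {m n h r : ℕ} (hh : h ≤ min m n) (hr : r + 2 * h = m + n) :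
    choi (canonicalBasis r) (eposic m n h r) =
      (((r : ℂ) + 1) / ((n : ℂ) + 1)) • projQ m r (m - h) n := by
  have hh' := le_min_iff.1 hh
  have hl : m - h ≤ min m r := by omega
  have hs : n + 2 * (m - h) = m + r := by omega
  obtain ⟨c, hc⟩ := exists_bentAlpha_J_eq hh hr
  have hVc : ∀ w, bentAlpha m n h r w =
      c • eta m r (m - h) n (LinearMap.adjoint (J n) w) := fun w => by
    rw [← hc, J_adjoint_J]
  have hVadj : ∀ z, LinearMap.adjoint (bentAlpha m n h r) z =
      conj c • J n (LinearMap.adjoint (eta m r (m - h) n) z) := fun z => by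
    refine ext_inner_right ℂ fun w => ?_
    rw [LinearMap.adjoint_inner_left, hVc, tensor_inner_smul_right, inner_smul_left,
      Complex.conj_conj, ← LinearMap.adjoint_inner_right, LinearMap.adjoint_inner_left]
  have hVV : bentAlpha m n h r ∘ₗ LinearMap.adjoint (bentAlpha m n h r) =
      (c * conj c) • projQ m r (m - h) n := by
    refine LinearMap.ext fun z => ?_
    rw [LinearMap.comp_apply, hVadj, map_smul, hc, smul_smul, LinearMap.smul_apply, projQ_apply,
      mul_comm]
  -- The squared Hilbert-Schmidt norm of the bent map, computed in two ways: it is that of the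
  -- isometry `α` on a space of dimension `r + 1`, and `|c|²` times that of an isometry on a space
  -- of dimension `n + 1`.
  have htr : c * conj c * (n + 1) = r + 1 := by
    have h1 := sum_inner_bentAlpha hh hr
    have h3 : ∀ k, inner ℂ (bentAlpha m n h r (conjBasis (canonicalBasis n) k))
        (bentAlpha m n h r (conjBasis (canonicalBasis n) k)) = c * conj c := fun k => by
      rw [hVc, tensor_inner_smul_left, tensor_inner_smul_right, inner_eta hl hs,
        LinearMap.adjoint_inner_left, J_adjoint_J, OrthonormalBasis.inner_eq_ite, if_pos rfl]
      ring
    rw [Finset.sum_congr rfl fun k _ => h3 k] at h1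
    simpa [mul_comm] using h1
  rw [choi_eposic_eq_bentAlpha, hVV, ← htr]
  congr 1
  have : (n : ℂ) + 1 ≠ 0 := by exact_mod_cast n.succ_ne_zero
  field_simp

/-! ### Counting the channels -/

/-- The rank of the Choi matrix recovers `n` from the channel, which separates the elements of `EC r
m`. -/
lemma finrank_range_choi_eposic {m n h r : ℕ} (hh : h ≤ min m n) (hr : r + 2 * h = m + n) :
    Module.finrank ℂ (LinearMap.range (choi (canonicalBasis r) (eposic m n h r))) = n + 1 := by
  have hh' := le_min_iff.1 hh
  have hl : m - h ≤ min m r := by omega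
  have hs : n + 2 * (m - h) = m + r := by omega
  have hc : ((r : ℂ) + 1) / ((n : ℂ) + 1) ≠ 0 :=
    div_ne_zero (by exact_mod_cast r.succ_ne_zero) (by exact_mod_cast n.succ_ne_zero)
  have hsurj : Function.Surjective (LinearMap.adjoint (eta m r (m - h) n)) :=
    Function.RightInverse.surjective (adjoint_eta_eta hl hs)
  rw [choi_eposic hh hr, LinearMap.range_smul _ _ hc, projQ,
    LinearMap.range_comp_of_range_eq_top _ (LinearMap.range_eq_top.2 hsurj)]
  exact finrank_rangeEta hl hs

lemma ncard_EC (r m : ℕ) : (EC r m).ncard = min r m + 1 := by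
  -- The parameter is `j = m - h`. With `r` and `m` fixed it determines `n = m + r - 2j` and `h`,
  -- and `0 ≤ h ≤ min m n` amounts to `0 ≤ j ≤ min r m`.
  let F : Fin (min r m + 1) → ((P r →ₗ[ℂ] P r) →ₗ[ℂ] (P m →ₗ[ℂ] P m)) :=
    fun j => eposic m (m + r - 2 * j) (m - j) r
  have hF : Function.Injective F := fun i j hij => by
    have h1 := finrank_range_choi_eposic (m := m) (n := m + r - 2 * i) (h := m - i) (r := r)
      (by omega) (by omega)
    have h2 := finrank_range_choi_eposic (m := m) (n := m + r - 2 * j) (h := m - j) (r := r)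
      (by omega) (by omega)
    have hij' : eposic m (m + r - 2 * i) (m - i) r = eposic m (m + r - 2 * j) (m - j) r := hij
    rw [hij', h2] at h1
    exact Fin.ext (by omega)
  have hEC : EC r m = Set.range F := by
    ext Φ
    constructor
    · rintro ⟨n, h, hh, hr, rfl⟩
      refine ⟨⟨m - h, by omega⟩, ?_⟩
      change eposic m (m + r - 2 * (m - h)) (m - (m - h)) r = _
      rw [show m + r - 2 * (m - h) = n by omega, show m - (m - h) = h by omega]
    · rintro ⟨j, rfl⟩
      exact ⟨_, _, by omega, by omega, rfl⟩
  rw [hEC, ← Set.image_univ, Set.ncard_image_of_injective _ hF, Set.ncard_univ]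
  simp

end Eposic

end

open Eposic in
theorem proposition3p13 :
    (∀ m n h r : ℕ, h ≤ min m n → r + 2 * h = m + n →
      ∃ W : Subrepresentation (tensorRep m r),
        -- `W` is the unique irreducible subspace of dimension `n + 1`
        (Representation.IsIrreducible (V := W.toSubmodule) W.toRepresentation ∧ Module.finrank ℂ W.toSubmodule = n + 1) ∧
        (∀ W' : Subrepresentation (tensorRep m r),
          Representation.IsIrreducible (V := W'.toSubmodule) W'.toRepresentation →
             Module.finrank ℂ W'.toSubmodule = n + 1 → W' = W) ∧
        -- `q_{m,r,m-h}` is the orthogonal projection onto `W`, the range of `η_{m,r,m-h}`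
        W.toSubmodule = LinearMap.range (eta m r (m - h) n) ∧
        projQ m r (m - h) n = W.toSubmodule.starProjection.toLinearMap ∧
        -- the Choi matrix of the EPOSIC channel
        choi (canonicalBasis r) (eposic m n h r) =
          (((r : ℂ) + 1) / ((n : ℂ) + 1)) • projQ m r (m - h) n) ∧
    (∀ r m : ℕ, (EC r m).ncard = min r m + 1) := by
  refine ⟨fun m n h r hh hr => ?_, ncard_EC⟩
  have hh' := le_min_iff.1 hh
  have hl : m - h ≤ min m r := by omega
  have hs : n + 2 * (m - h) = m + r := by omega
  exact ⟨rangeEta hl hs, ⟨isIrreducible_rangeEta hl hs, finrank_rangeEta hl hs⟩,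
    eq_rangeEta hl hs, rfl, projQ_eq_starProjection hl hs, choi_eposic hh hr⟩
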